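/- Let $z_1,z_2,\dots$ be i.i.d. observations with distribution $F_0$ on a measurable space. Let $m(z,\beta,\gamma)\in\mathbb R^r$ and $\phi(z,\beta,\gamma,\lambda)\in\mathbb R^r$ be moment functions, where $\beta\in\mathbb R^p$ and the first steps $\gamma,\lambda$ range over real vector spaces $\Gamma,\Lambda$; put $\psi=m+\phi$. Let $\beta_0,\gamma_0,\lambda_0$ be the true values, with $E[m(z_i,\beta_0,\gamma_0)]=0$ and $E[\phi(z_i,\beta_0,\gamma_0,\lambda_0)]=0$. Write $\phi(z,\gamma,\lambda)=\phi(z,\beta_0,\gamma,\lambda)$, $\bar\phi(\gamma,\lambda)=E[\phi(z_i,\gamma,\lambda)]$ and $\bar\psi(\gamma,\lambda)=E[\psi(z_i,\beta_0,\gamma,\lambda)]$. Fix $L$. For each $n$ partition $\{1,\dots,n\}$ into groups $I_1,\dots,I_L$, let $\hat\gamma_\ell,\hat\lambda_\ell$ be functions of the observations $z_i$, $i\le n$, $i\notin I_\ell$, and let $\hat\psi(\beta)=\frac1n\sum_{\ell=1}^L\sum_{i\in I_\ell}\psi(z_i,\beta,\hat\gamma_\ell,\hat\lambda_\ell)$.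 (The functions of the data below are assumed to be measurable.) Let $B\subseteq\mathbb R^p$ have $\beta_0$ in its interior, let $\hat W$ be random positive semidefinite $r\times r$ matrices, and let $\hat\beta$ be a random vector that minimizes $\hat\psi(\beta)^T\hat W\hat\psi(\beta)$ over $\beta\in B$. Assume the following, where $\overset{p}{\to}$ is convergence in probability as $n\to\infty$. 1. (Mean-square consistency.) For each $\ell$: either $m(z,\beta_0,\gamma)$ does not depend on $z$ or $\int\|m(z,\beta_0,\hat\gamma_\ell)-m(z,\beta_0,\gamma_0)\|^2F_0(dz)\overset{p}{\to}0$; and $\int\|\phi(z,\hat\gamma_\ell,\lambda_0)-\phi(z,\gamma_0,\lambda_0)\|^2F_0(dz)\overset{p}{\to}0$ and $\int\|\phi(z,\gamma_0,\hat\lambda_\ell)-\phi(z,\gamma_0,\lambda_0)\|^2F_0(dz)\overset{p}{\to}0$. 2. (Second-order remainder.) For each $\ell$, either $\sqrt n\int\max_j|\phi_j(z,\hat\gamma_\ell,\hat\lambda_\ell)-\phi_j(z,\gamma_0,\hat\lambda_\ell)-\phi_j(z,\hat\gamma_\ell,\lambda_0)+\phi_j(z,\gamma_0,\lambda_0)|F_0(dz)\overset{p}{\to}0$,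 or $\hat R_2=\frac1{\sqrt n}\sum_{k=1}^L\sum_{i\in I_k}[\phi(z_i,\hat\gamma_k,\hat\lambda_k)-\phi(z_i,\hat\gamma_k,\lambda_0)-\phi(z_i,\gamma_0,\hat\lambda_k)+\phi(z_i,\gamma_0,\lambda_0)]\overset{p}{\to}0$. 3. (Rates.) For each $\ell$, $\sqrt n\,\bar\psi(\hat\gamma_\ell,\lambda_0)\overset{p}{\to}0$ and $\sqrt n\,\bar\phi(\gamma_0,\hat\lambda_\ell)\overset{p}{\to}0$. 4. (Jacobian regularity.) The matrix $M=E[\partial\psi(z_i,\beta,\gamma_0,\lambda_0)/\partial\beta|_{\beta=\beta_0}]$ exists, and there are a neighborhood $\mathcal N$ of $\beta_0$ and (semi)norms on $\Gamma$ and $\Lambda$ such that: (i) for each $\ell$, $\|\hat\gamma_\ell-\gamma_0\|\overset{p}{\to}0$ and $\|\hat\lambda_\ell-\lambda_0\|\overset{p}{\to}0$; (ii) there are $\delta>0$, $\zeta'>0$ and $d$ with $E[|d(z_i)|]<\infty$ such that for all $\gamma,\lambda$ with $\|\gamma-\gamma_0\|<\delta$ and $\|\lambda-\lambda_0\|<\delta$,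 with probability one, $\psi(z_i,\beta,\gamma,\lambda)$ is differentiable in $\beta$ on $\mathcal N$ and $\left\|\frac{\partial\psi(z_i,\beta,\gamma,\lambda)}{\partial\beta}-\frac{\partial\psi(z_i,\beta_0,\gamma,\lambda)}{\partial\beta}\right\|\le d(z_i)\|\beta-\beta_0\|^{\zeta'}$ for all $\beta\in\mathcal N$; (iii) for each $\ell,j,k$, $\int\left|\frac{\partial\psi_j(z,\beta_0,\hat\gamma_\ell,\hat\lambda_\ell)}{\partial\beta_k}-\frac{\partial\psi_j(z,\beta_0,\gamma_0,\lambda_0)}{\partial\beta_k}\right|F_0(dz)\overset{p}{\to}0$. 5. $\hat\beta\overset{p}{\to}\beta_0$, $\hat W\overset{p}{\to}W$, $M^TWM$ is nonsingular, and $E[\|\psi(z_i,\beta_0,\gamma_0,\lambda_0)\|^2]<\infty$. Then, with $\Omega=E[\psi(z_i,\beta_0,\gamma_0,\lambda_0)\psi(z_i,\beta_0,\gamma_0,\lambda_0)^T]$ and $V=(M^TWM)^{-1}M^TW\Omega WM(M^TWM)^{-1}$ (a positive semidefinite matrix), $$\sqrt n(\hat\beta-\beta_0)\overset{d}{\longrightarrow}N(0,V).$$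 -/

import Mathlib

open MeasureTheory ProbabilityTheory Filter Topology Matrix
open scoped ENNReal

/-- Euclidean `k`-space. -/
abbrev Vec (k : ℕ) : Type := EuclideanSpace ℝ (Fin k)

/-- The ingredients of a semiparametric moment condition: the original moment function
`m(z, β, γ)`, the adjustment term `φ(z, β, γ, λ)`, and the true values of the parameter of
interest `β ∈ ℝᵖ` and of the two first steps `γ ∈ Γ`, `λ ∈ Λ`. -/
structure MomentModel (Z Γ Λ : Type*) (p r : ℕ) where
  m : Z → Vec p → Γ → Vec r
  φ : Z → Vec p → Γ → Λ → Vec r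
  β₀ : Vec p
  γ₀ : Γ
  lam₀ : Λ

/-- Cross-fitting with `L` groups. For each sample size `n` the observation indices are partitioned
into the groups `I_ℓ = {i | fold n i = ℓ}`, and the first steps `γ̂_ℓ`, `λ̂_ℓ` are functions of the
observations that are not in group `ℓ`. -/
structure CrossFit (Z Γ Λ : Type*) (L : ℕ) where
  fold : (n : ℕ) → Fin n → Fin L
  gammaHat : (n : ℕ) → (ℓ : Fin L) → ({i : Fin n // fold n i ≠ ℓ} → Z) → Γ
  lamHat : (n : ℕ) → (ℓ : Fin L) → ({i : Fin n // fold n i ≠ ℓ} → Z) → Λ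

/-- The Jacobian matrix `∂f_j/∂β_k` at `β`. -/
noncomputable def jacobian {p r : ℕ} (f : Vec p → Vec r) (β : Vec p) :
    Matrix (Fin r) (Fin p) ℝ :=
  Matrix.of fun j k => (fderiv ℝ f β (EuclideanSpace.single k 1)) j

/-- Convergence in probability to zero of nonnegative, possibly infinite, random quantities. -/
def TendstoZeroInProb {Ω : Type*} [MeasurableSpace Ω] (P : Measure Ω) (X : ℕ → Ω → ℝ≥0∞) : Prop :=
  ∀ ε : ℝ≥0∞, 0 < ε → Tendsto (fun n => P {ω | ε ≤ X n ω}) atTop (𝓝 0)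

namespace MomentModel

variable {Z Γ Λ : Type*} {p r : ℕ} (S : MomentModel Z Γ Λ p r)

/-- The adjusted moment function `ψ = m + φ`. -/
def ψ (z : Z) (β : Vec p) (γ : Γ) (lam : Λ) : Vec r :=
  S.m z β γ + S.φ z β γ lam

/-- `ψ` at the true values. -/
def ψ₀ (z : Z) : Vec r := S.ψ z S.β₀ S.γ₀ S.lam₀

variable [MeasurableSpace Z] (F₀ : Measure Z)

/-- `φ̄(γ, λ) = E[φ(z, β₀, γ, λ)]`. -/
noncomputable def phiBar (γ : Γ) (lam : Λ) : Vec r := ∫ z, S.φ z S.β₀ γ lam ∂F₀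

/-- `ψ̄(γ, λ) = E[ψ(z, β₀, γ, λ)]`. -/
noncomputable def psiBar (γ : Γ) (lam : Λ) : Vec r := ∫ z, S.ψ z S.β₀ γ lam ∂F₀

/-- The Jacobian of `β ↦ ψ(z, β, γ, λ)` at `β₀`. -/
noncomputable def jac₀ (z : Z) (γ : Γ) (lam : Λ) : Matrix (Fin r) (Fin p) ℝ :=
  jacobian (fun β => S.ψ z β γ lam) S.β₀

/-- `M = E[∂ψ(z, β, γ₀, λ₀)/∂β]` at `β = β₀`. -/
noncomputable def M : Matrix (Fin r) (Fin p) ℝ :=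
  Matrix.of fun j k => ∫ z, S.jac₀ z S.γ₀ S.lam₀ j k ∂F₀

/-- `Ω = E[ψ₀ ψ₀ᵀ]`. -/
noncomputable def Omega : Matrix (Fin r) (Fin r) ℝ :=
  Matrix.of fun j k => ∫ z, S.ψ₀ z j * S.ψ₀ z k ∂F₀

/-- `V = (MᵀWM)⁻¹ MᵀWΩWM (MᵀWM)⁻¹`. -/
noncomputable def V (W : Matrix (Fin r) (Fin r) ℝ) : Matrix (Fin p) (Fin p) ℝ :=
  ((S.M F₀)ᵀ * W * S.M F₀)⁻¹ * (S.M F₀)ᵀ * W * S.Omega F₀ * W * S.M F₀ *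
    ((S.M F₀)ᵀ * W * S.M F₀)⁻¹

/-- The original moments and the adjustment have expectation zero at the true values. -/
structure MeanZero : Prop where
  integrable_m : Integrable (fun z => S.m z S.β₀ S.γ₀) F₀
  integral_m : ∫ z, S.m z S.β₀ S.γ₀ ∂F₀ = 0
  integrable_phi : Integrable (fun z => S.φ z S.β₀ S.γ₀ S.lam₀) F₀
  integral_phi : ∫ z, S.φ z S.β₀ S.γ₀ S.lam₀ ∂F₀ = 0

/-- On `N`, `ψ(z, β, γ, λ)` is differentiable in `β`, and its derivative is Hölder at `β₀` with
exponent `ζ` and constant `d z`. -/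
def SmoothOn (N : Set (Vec p)) (ζ : ℝ) (d : Z → ℝ) (z : Z) (γ : Γ) (lam : Λ) : Prop :=
  ∀ β ∈ N, DifferentiableAt ℝ (fun b => S.ψ z b γ lam) β ∧
    ‖fderiv ℝ (fun b => S.ψ z b γ lam) β - fderiv ℝ (fun b => S.ψ z b γ lam) S.β₀‖
      ≤ d z * ‖β - S.β₀‖ ^ ζ

end MomentModel

namespace CrossFit

variable {Ω Z Γ Λ : Type*} {L : ℕ} (C : CrossFit Z Γ Λ L) (z : ℕ → Ω → Z)

/-- The observations outside group `ℓ`. -/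
abbrev Train (n : ℕ) (ℓ : Fin L) : Type _ := {i : Fin n // C.fold n i ≠ ℓ} → Z

/-- The realized first step `γ̂_ℓ`, for the sample `z 0, …, z (n - 1)`. -/
def gam (n : ℕ) (ℓ : Fin L) (ω : Ω) : Γ := C.gammaHat n ℓ fun i => z i.1 ω

/-- The realized first step `λ̂_ℓ`, for the sample `z 0, …, z (n - 1)`. -/
def lam (n : ℕ) (ℓ : Fin L) (ω : Ω) : Λ := C.lamHat n ℓ fun i => z i.1 ω

/-- The cross-fit sample moments `ψ̂(β) = n⁻¹ ∑_ℓ ∑_{i ∈ I_ℓ} ψ(z_i, β, γ̂_ℓ, λ̂_ℓ)`. -/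
noncomputable def psiHat {p r : ℕ} (S : MomentModel Z Γ Λ p r) (n : ℕ) (β : Vec p) (ω : Ω) :
    Vec r :=
  (n : ℝ)⁻¹ • ∑ ℓ : Fin L, ∑ i : Fin n with C.fold n i = ℓ,
    S.ψ (z i ω) β (C.gam z n ℓ ω) (C.lam z n ℓ ω)

/-- The second order remainder `R̂₂`. -/
noncomputable def R₂ {p r : ℕ} (S : MomentModel Z Γ Λ p r) (n : ℕ) (ω : Ω) : Vec r :=
  (√(n : ℝ))⁻¹ • ∑ ℓ : Fin L, ∑ i : Fin n with C.fold n i = ℓ,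
    (S.φ (z i ω) S.β₀ (C.gam z n ℓ ω) (C.lam z n ℓ ω)
      - S.φ (z i ω) S.β₀ (C.gam z n ℓ ω) S.lam₀
      - S.φ (z i ω) S.β₀ S.γ₀ (C.lam z n ℓ ω)
      + S.φ (z i ω) S.β₀ S.γ₀ S.lam₀)

/-- The GMM criterion `ψ̂(β)ᵀ Ŵ ψ̂(β)`. -/
noncomputable def criterion {p r : ℕ} (S : MomentModel Z Γ Λ p r)
    (What : Matrix (Fin r) (Fin r) ℝ) (n : ℕ) (ω : Ω) (β : Vec p) : ℝ :=
  (C.psiHat z S n β ω).ofLp ⬝ᵥ (What *ᵥ (C.psiHat z S n β ω).ofLp)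

variable {p r : ℕ} [MeasurableSpace Z] (S : MomentModel Z Γ Λ p r) (F₀ : Measure Z)

/-- The law of the observations outside group `ℓ`, together with one observation of group `ℓ`. -/
noncomputable def jointLaw (n : ℕ) (ℓ : Fin L) : Measure (C.Train n ℓ × Z) :=
  (Measure.pi fun _ => F₀).prod F₀

/-- Regularity of the first steps: the moment functions at the estimated first steps are measurable
jointly in the observations used for estimation and in a further observation. -/
structure JointlyMeasurable : Prop where
  m_hat : ∀ n ℓ, Measurable fun q : C.Train n ℓ × Z => S.m q.2 S.β₀ (C.gammaHat n ℓ q.1)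
  phi_hat : ∀ n ℓ, Measurable fun q : C.Train n ℓ × Z =>
    S.φ q.2 S.β₀ (C.gammaHat n ℓ q.1) (C.lamHat n ℓ q.1)
  phi_gam : ∀ n ℓ, Measurable fun q : C.Train n ℓ × Z =>
    S.φ q.2 S.β₀ (C.gammaHat n ℓ q.1) S.lam₀
  phi_lam : ∀ n ℓ, Measurable fun q : C.Train n ℓ × Z =>
    S.φ q.2 S.β₀ S.γ₀ (C.lamHat n ℓ q.1)
  jac_hat : ∀ n ℓ j k, AEMeasurable (fun q : C.Train n ℓ × Z =>
    S.jac₀ q.2 (C.gammaHat n ℓ q.1) (C.lamHat n ℓ q.1) j k) (C.jointLaw F₀ n ℓ)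

variable [MeasurableSpace Ω] (P : Measure Ω)

/-- Mean-square consistency of the first steps. -/
structure MeanSquareConsistent : Prop where
  m_conv : ∀ ℓ, (∀ γ z₁ z₂, S.m z₁ S.β₀ γ = S.m z₂ S.β₀ γ) ∨
    TendstoZeroInProb P fun (n : ℕ) ω =>
      ∫⁻ x, ‖S.m x S.β₀ (C.gam z n ℓ ω) - S.m x S.β₀ S.γ₀‖ₑ ^ 2 ∂F₀
  phi_gam_conv : ∀ ℓ, TendstoZeroInProb P fun (n : ℕ) ω =>
    ∫⁻ x, ‖S.φ x S.β₀ (C.gam z n ℓ ω) S.lam₀ - S.φ x S.β₀ S.γ₀ S.lam₀‖ₑ ^ 2 ∂F₀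
  phi_lam_conv : ∀ ℓ, TendstoZeroInProb P fun (n : ℕ) ω =>
    ∫⁻ x, ‖S.φ x S.β₀ S.γ₀ (C.lam z n ℓ ω) - S.φ x S.β₀ S.γ₀ S.lam₀‖ₑ ^ 2 ∂F₀

/-- The second order remainder condition: for each group, either the expected interaction remainder
vanishes faster than `n^(-1/2)`, or `R̂₂` converges to zero in probability. -/
def SecondOrderRemainder : Prop :=
  ∀ ℓ, (TendstoZeroInProb P fun (n : ℕ) ω => ENNReal.ofReal √(n : ℝ) *
      ∫⁻ x, ⨆ j, ‖(S.φ x S.β₀ (C.gam z n ℓ ω) (C.lam z n ℓ ω)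
        - S.φ x S.β₀ S.γ₀ (C.lam z n ℓ ω)
        - S.φ x S.β₀ (C.gam z n ℓ ω) S.lam₀
        + S.φ x S.β₀ S.γ₀ S.lam₀) j‖ₑ ∂F₀) ∨
    TendstoInMeasure P (fun (n : ℕ) ω => C.R₂ z S n ω) atTop fun _ => 0

/-- The rate conditions `√n ψ̄(γ̂_ℓ, λ₀) → 0` and `√n φ̄(γ₀, λ̂_ℓ) → 0` in probability. -/
structure RateConditions : Prop where
  psiBar_conv : ∀ ℓ, TendstoInMeasure P
    (fun (n : ℕ) ω => √(n : ℝ) • S.psiBar F₀ (C.gam z n ℓ ω) S.lam₀) atTop fun _ => 0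
  phiBar_conv : ∀ ℓ, TendstoInMeasure P
    (fun (n : ℕ) ω => √(n : ℝ) • S.phiBar F₀ S.γ₀ (C.lam z n ℓ ω)) atTop fun _ => 0

/-- Jacobian regularity. `M` exists, and there are a neighborhood `N` of `β₀` and (semi)norms on the
first steps for which the first steps are consistent, `ψ` is almost surely differentiable on `N`
with a derivative that is Hölder at `β₀`, for each `(γ, λ)` close to `(γ₀, λ₀)`; and the Jacobian is
mean consistent. The clause `NullMeasurableSet` says that differentiability at the estimated
first steps is an event. -/
def JacobianRegular [AddCommGroup Γ] [Module ℝ Γ] [AddCommGroup Λ] [Module ℝ Λ] : Prop :=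
  (∀ j k, Integrable (fun x => S.jac₀ x S.γ₀ S.lam₀ j k) F₀) ∧
  (∃ N ∈ 𝓝 S.β₀, ∃ (normΓ : Seminorm ℝ Γ) (normΛ : Seminorm ℝ Λ),
    (∀ ℓ, TendstoInMeasure P (fun (n : ℕ) ω => normΓ (C.gam z n ℓ ω - S.γ₀)) atTop fun _ => 0) ∧
    (∀ ℓ, TendstoInMeasure P (fun (n : ℕ) ω => normΛ (C.lam z n ℓ ω - S.lam₀)) atTop fun _ => 0) ∧
    ∃ (δ ζ : ℝ) (d : Z → ℝ), 0 < δ ∧ 0 < ζ ∧ Integrable d F₀ ∧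
      (∀ γ lam, normΓ (γ - S.γ₀) < δ → normΛ (lam - S.lam₀) < δ →
        ∀ᵐ x ∂F₀, S.SmoothOn N ζ d x γ lam) ∧
      ∀ n ℓ, NullMeasurableSet
        {q : C.Train n ℓ × Z | S.SmoothOn N ζ d q.2 (C.gammaHat n ℓ q.1) (C.lamHat n ℓ q.1)}
        (C.jointLaw F₀ n ℓ)) ∧
  (∀ ℓ j k, TendstoZeroInProb P fun (n : ℕ) ω =>
    ∫⁻ x, ‖S.jac₀ x (C.gam z n ℓ ω) (C.lam z n ℓ ω) j k - S.jac₀ x S.γ₀ S.lam₀ j k‖ₑ ∂F₀)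

end CrossFit

/-! The argument has two halves, joined by the first order condition of GMM.

Moments at `β₀`. Write `ψ(z, β₀, γ̂, λ̂) - ψ₀(z)` as the effect of `γ̂` on `m`, the effect of `γ̂`
on `φ`, the effect of `λ̂` on `φ`, and an interaction, which is a second difference of `φ`. By
cross-fitting, the first steps of a group are independent of the observations in it. Given the
training sample, the summands of each effect are thus i.i.d., and their centered normalized sum has
conditional variance at most the mean-square error (`tendsto_sum_sub`). The conditional means are
controlled by the rate conditions: the two effects of `γ̂` add up to `ψ̄(γ̂, λ₀)`, and the effect of
`λ̂` is `φ̄(γ₀, λ̂)`. The interaction is negligible by assumption, or by a conditional Markov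
inequality (`tendsto_avg`). Hence `√n ψ̂(β₀)` differs from `n^(-1/2) ∑ ψ₀(z_i)` by a term that tends
to zero in probability (`tendsto_psiHat_sub`).

Linearization. With probability tending to one, `β̂` is an interior minimizer and the moments are
smooth near `β₀`, so that `Gᵀ Ŵ (ψ̂(β₀) + H (β̂ - β₀)) = 0` with `G` and `H` both tending to `M`
(`exists_tendsto_expanded_foc`). Solving for `β̂ - β₀` gives `√n (β̂ - β₀) = -K √n ψ̂(β₀)`, where
`K` tends to `A = (MᵀWM)⁻¹MᵀW`. The central limit theorem for `-A ψ₀` and Slutsky's lemma finish the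
proof.

Convergence in probability is expressed throughout as convergence along one filter on `ℕ × Ω`, so
that continuity, squeezing and finite intersections of events are handled by filter calculus. -/

/-! ### Convergence in probability as convergence along a filter -/

section ProbFilter

variable {Ω : Type*} [MeasurableSpace Ω]

/-- The filter on `ℕ × Ω` of events that hold with probability tending to one. -/
def probFilter (P : Measure Ω) : Filter (ℕ × Ω) where
  sets := {U | Tendsto (fun n => P {ω | (n, ω) ∉ U}) atTop (𝓝 0)}
  univ_sets := by simp
  sets_of_superset {U V} hU hUV := by
    refine tendsto_of_tendsto_of_tendsto_of_le_of_le tendsto_const_nhds hU (fun _ => zero_le) ?_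
    exact fun n => measure_mono fun ω h h' => h (hUV h')
  inter_sets {U V} hU hV := by
    have h : Tendsto (fun n => P {ω | (n, ω) ∉ U} + P {ω | (n, ω) ∉ V}) atTop (𝓝 0) := by
      simpa using Tendsto.add hU hV
    refine tendsto_of_tendsto_of_tendsto_of_le_of_le tendsto_const_nhds h (fun _ => zero_le) ?_
    refine fun n => (measure_mono fun ω hω => ?_).trans (measure_union_le _ _)
    simp only [Set.mem_ofPred_eq, Set.mem_inter_iff, not_and_or] at hω
    exact hω

variable {P : Measure Ω}

lemma eventually_probFilter {p : ℕ × Ω → Prop} :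
    (∀ᶠ q in probFilter P, p q) ↔ Tendsto (fun n => P {ω | ¬ p (n, ω)}) atTop (𝓝 0) := Iff.rfl

lemma eventually_probFilter_of_ae {p : ℕ × Ω → Prop} (h : ∀ n, ∀ᵐ ω ∂P, p (n, ω)) :
    ∀ᶠ q in probFilter P, p q := by
  rw [eventually_probFilter]
  simp [fun n => (ae_iff.1 (h n))]

/-- No measurability is needed, because `P` acts as an outer measure on arbitrary sets. This later
permits first order expansions whose matrices are merely chosen, not constructed measurably. -/
lemma tendstoInMeasure_const_iff {E : Type*} [PseudoEMetricSpace E] {X : ℕ → Ω → E} {c : E} :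
    TendstoInMeasure P X atTop (fun _ => c) ↔
      Tendsto (fun q : ℕ × Ω => X q.1 q.2) (probFilter P) (𝓝 c) := by
  rw [Metric.nhds_basis_eball.tendsto_right_iff]
  refine forall₂_congr fun ε hε => ?_
  simp [eventually_probFilter]

lemma tendstoZeroInProb_iff {X : ℕ → Ω → ℝ≥0∞} :
    TendstoZeroInProb P X ↔ Tendsto (fun q : ℕ × Ω => X q.1 q.2) (probFilter P) (𝓝 0) := by
  rw [ENNReal.nhds_zero_basis.tendsto_right_iff]
  refine forall₂_congr fun ε hε => ?_
  simp [eventually_probFilter]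

/-- Boundedness in probability. -/
def BddInProb (P : Measure Ω) (X : ℕ → Ω → ℝ) : Prop :=
  ∀ ε : ℝ≥0∞, 0 < ε → ∃ K : ℝ, ∀ n, P {ω | K < |X n ω|} ≤ ε

lemma tendsto_mul_of_bddInProb {X : ℕ → Ω → ℝ} (hX : BddInProb P X) {A : ℕ × Ω → ℝ}
    (hA : Tendsto A (probFilter P) (𝓝 0)) :
    Tendsto (fun q => A q * X q.1 q.2) (probFilter P) (𝓝 0) := by
  rw [Metric.nhds_basis_closedBall.tendsto_right_iff]
  intro η hη
  rw [eventually_probFilter, ENNReal.tendsto_nhds_zero]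
  intro ε hε
  obtain ⟨K, hK⟩ := hX (ε / 2) (ENNReal.half_pos hε.ne')
  have hA' : ∀ᶠ q in probFilter P, |A q| ≤ η / (|K| + 1) := by
    have := Metric.nhds_basis_closedBall.tendsto_right_iff.1 hA (η / (|K| + 1)) (by positivity)
    simpa using this
  rw [eventually_probFilter, ENNReal.tendsto_nhds_zero] at hA'
  filter_upwards [hA' (ε / 2) (ENNReal.half_pos hε.ne')] with n hn
  calc _ ≤ P ({ω | ¬ |A (n, ω)| ≤ η / (|K| + 1)} ∪ {ω | K < |X n ω|}) := by
        refine measure_mono fun ω hω => ?_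
        by_contra hc
        simp only [Set.mem_union, Set.mem_ofPred_eq, not_or, not_not, not_lt] at hc
        apply hω
        simp only [Metric.mem_closedBall, dist_zero_right, norm_mul, Real.norm_eq_abs]
        calc _ ≤ η / (|K| + 1) * (|K| + 1) := by
              gcongr
              · exact hc.1
              · exact hc.2.trans ((le_abs_self K).trans (by linarith))
          _ = η := by field_simp
    _ ≤ ε / 2 + ε / 2 := (measure_union_le _ _).trans (add_le_add hn (hK n))
    _ = ε := ENNReal.add_halves ε

/-- Passes from conditional bounds to convergence: `G` is a conditional moment given the training
sample, and the tail bound is Markov's (`c η = η`) or Chebyshev's (`c η = η ^ 2`). For a fixed level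
`η`, taking `ε` below `δ / 2 * c η` makes the second term at most `δ / 2`. -/
lemma tendsto_zero_of_le_add {X G : ℕ × Ω → ℝ≥0∞} {c : ℝ≥0∞ → ℝ≥0∞}
    (hc : ∀ η, 0 < η → η ≠ ∞ → 0 < c η)
    (hG : Tendsto G (probFilter P) (𝓝 0))
    (h : ∀ n η ε, 0 < η → η ≠ ∞ → 0 < ε → ε ≠ ∞ →
      P {ω | η ≤ X (n, ω)} ≤ P {ω | ε ≤ G (n, ω)} + ε / c η) :
    Tendsto X (probFilter P) (𝓝 0) := by
  rw [ENNReal.tendsto_nhds_zero]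
  intro η₀ hη₀
  obtain ⟨η, hη, hηlt⟩ := exists_between hη₀
  have hηt : η ≠ ∞ := (hηlt.trans_le le_top).ne
  rw [eventually_probFilter, ENNReal.tendsto_nhds_zero]
  intro δ hδ
  obtain ⟨ε, hε0, hε⟩ : ∃ ε : ℝ≥0∞, 0 < ε ∧ ε < min (δ / 2 * c η) ∞ := by
    refine exists_between (lt_min ?_ ENNReal.zero_lt_top)
    exact ENNReal.mul_pos (ENNReal.half_pos hδ.ne').ne' (hc η hη hηt).ne'
  rw [lt_min_iff] at hε
  have hG' := ENNReal.nhds_zero_basis.tendsto_right_iff.1 hG ε hε0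
  rw [eventually_probFilter, ENNReal.tendsto_nhds_zero] at hG'
  filter_upwards [hG' (δ / 2) (ENNReal.half_pos hδ.ne')] with n hn
  calc _ ≤ P {ω | η ≤ X (n, ω)} := measure_mono fun ω hω => by
          simp only [Set.mem_ofPred_eq, not_le] at hω ⊢; exact (hηlt.trans hω).le
    _ ≤ P {ω | ε ≤ G (n, ω)} + ε / c η := h n η ε hη hηt hε0 hε.2.ne
    _ ≤ δ / 2 + δ / 2 := by
        refine add_le_add ?_ (ENNReal.div_le_of_le_mul hε.1.le)
        simpa using hn
    _ = δ := ENNReal.add_halves δ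

end ProbFilter

/-! ### Markov and Chebyshev inequalities given the training sample -/

section Conditional

variable {Ω 𝒯 Z : Type*} [MeasurableSpace Ω] [MeasurableSpace 𝒯] [MeasurableSpace Z]
  {P : Measure Ω} {τ : Measure 𝒯} {F : Measure Z}
  [IsProbabilityMeasure F]

/-- A conditional Markov inequality, given a random element `T`. -/
lemma measure_avg_ge_le [IsProbabilityMeasure τ] {κ : Type*} [Fintype κ] {T : Ω → 𝒯} {g : Ω → κ → Z}
    (hx : ∀ i, HasLaw (fun ω => (T ω, g ω i)) (τ.prod F) P)
    {h : 𝒯 × Z → ℝ≥0∞} (hh : Measurable h) {n : ℕ} (hn : Fintype.card κ ≤ n) {η ε : ℝ≥0∞}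
    (hη : 0 < η) (hηt : η ≠ ∞) :
    P {ω | η ≤ (n : ℝ≥0∞)⁻¹ * ∑ i, h (T ω, g ω i)} ≤
      P {ω | ε ≤ ∫⁻ y, h (T ω, y) ∂F} + ε / η := by
  have hG : Measurable fun t => ∫⁻ y, h (t, y) ∂F := hh.lintegral_prod_right'
  -- Truncating `h` to the values of `T` with conditional mean below `ε` makes its unconditional
  -- mean at most `ε`, so that the ordinary Markov inequality applies without conditional
  -- expectations.
  set A : Set 𝒯 := {t | ∫⁻ y, h (t, y) ∂F < ε}
  have hA : MeasurableSet A := measurableSet_lt hG measurable_const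
  set h1 : 𝒯 × Z → ℝ≥0∞ := (Prod.fst ⁻¹' A).indicator h
  have hh1 : Measurable h1 := hh.indicator (measurable_fst hA)
  have hint : ∫⁻ q, h1 q ∂(τ.prod F) ≤ ε := by
    rw [lintegral_prod _ hh1.aemeasurable]
    refine (lintegral_mono (g := fun _ => ε) fun t => ?_).trans (by simp)
    by_cases ht : t ∈ A
    · simp only [h1, Set.indicator, Set.mem_preimage, ht, if_true]
      exact le_of_lt ht
    · simp [h1, ht]
  have hm : ∀ i, AEMeasurable (fun ω => h1 (T ω, g ω i)) P := fun i =>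
    hh1.comp_aemeasurable (hx i).aemeasurable
  calc _ ≤ P ({ω | ε ≤ ∫⁻ y, h (T ω, y) ∂F} ∪
        {ω | η ≤ (n : ℝ≥0∞)⁻¹ * ∑ i, h1 (T ω, g ω i)}) := by
        refine measure_mono fun ω hω => ?_
        by_cases hT : T ω ∈ A
        · right
          simpa [h1, Set.indicator, hT] using hω
        · left
          simpa [A] using hT
    _ ≤ _ := measure_union_le _ _
    _ ≤ _ := by
        gcongr
        refine (meas_ge_le_lintegral_div
          ((Finset.aemeasurable_fun_sum _ fun i _ => hm i).const_mul _) hη.ne' hηt).trans ?_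
        gcongr
        rw [lintegral_const_mul'' _ (Finset.aemeasurable_fun_sum _ fun i _ => hm i),
          lintegral_finsetSum' _ fun i _ => hm i]
        have he : ∀ i, ∫⁻ ω, h1 (T ω, g ω i) ∂P ≤ ε := fun i => by
          rw [(hx i).lintegral_comp (f := h1) hh1.aemeasurable]; exact hint
        calc _ ≤ (n : ℝ≥0∞)⁻¹ * ∑ i : κ, ε := by gcongr with i; exact he i
          _ = (n : ℝ≥0∞)⁻¹ * (Fintype.card κ) * ε := by simp [mul_assoc]
          _ ≤ (n : ℝ≥0∞)⁻¹ * n * ε := by gcongr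
          _ ≤ 1 * ε := by gcongr; exact ENNReal.inv_mul_le_one _
          _ = ε := one_mul _

/-- Chebyshev's inequality. By independence the variance of the sum is the number of summands times
`Var f`; as there are at most `n` of them, the normalized sum has variance at most `E[f ^ 2]`. -/
lemma pi_measure_sum_sub_ge_le {κ : Type*} [Fintype κ] {f : Z → ℝ} (hf : MemLp f 2 F) {n : ℕ}
    (hn : Fintype.card κ ≤ n) {η : ℝ≥0∞} (hη : 0 < η) (hηt : η ≠ ∞) :
    Measure.pi (fun _ : κ => F) {y | η ≤ ‖(√(n : ℝ))⁻¹ * ∑ i, (f (y i) - ∫ x, f x ∂F)‖ₑ} ≤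
      (∫⁻ x, ‖f x‖ₑ ^ 2 ∂F) / η ^ 2 := by
  have hfi : ∀ i : κ, MemLp (fun y : κ → Z => f (y i)) 2 (Measure.pi fun _ => F) := fun i =>
    hf.comp_measurePreserving (measurePreserving_eval (fun _ => F) i)
  set X : (κ → Z) → ℝ := fun y => (√(n : ℝ))⁻¹ * ∑ i, f (y i)
  have hX : MemLp X 2 (Measure.pi fun _ => F) := (memLp_finsetSum _ fun i _ => hfi i).const_mul _
  have hEi : ∀ i : κ, ∫ y : κ → Z, f (y i) ∂(Measure.pi fun _ => F) = ∫ x, f x ∂F := fun i =>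
    (measurePreserving_eval (fun _ : κ => F) i).hasLaw.integral_comp hf.1
  have hE : ∫ y, X y ∂(Measure.pi fun _ => F) =
      (√(n : ℝ))⁻¹ * ∑ i : κ, ∫ x, f x ∂F := by
    simp only [X]
    rw [integral_const_mul, integral_finsetSum _ fun i _ => (hfi i).integrable one_le_two]
    simp_rw [hEi]
  have hV : Var[X; Measure.pi fun _ => F] ≤ ∫ x, f x ^ 2 ∂F := by
    have h1 : Var[∑ i : κ, fun y : κ → Z => f (y i); Measure.pi fun _ => F] =
        ∑ i : κ, Var[f; F] := variance_sum_pi (X := fun _ => f) fun _ => hf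
    have h2 : X = fun y => (√(n : ℝ))⁻¹ * (∑ i : κ, fun y : κ → Z => f (y i)) y := by
      ext y; simp [X]
    rw [h2, variance_const_mul, h1, Finset.sum_const, Finset.card_univ, nsmul_eq_mul, ← mul_assoc]
    calc _ ≤ 1 * Var[f; F] := by
          gcongr
          · exact variance_nonneg _ _
          · rw [inv_pow, Real.sq_sqrt (Nat.cast_nonneg _)]
            exact inv_mul_le_one_of_le₀ (by exact_mod_cast hn) (Nat.cast_nonneg _)
      _ ≤ _ := by rw [one_mul]; exact variance_le_expectation_sq hf.1
  have hc : 0 < η.toReal := ENNReal.toReal_pos hη.ne' hηt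
  calc _ = Measure.pi (fun _ : κ => F) {y | η.toReal ≤ |X y - ∫ y, X y ∂(Measure.pi fun _ => F)|} := by
        congr 1
        ext y
        rw [Set.mem_ofPred_eq, Set.mem_ofPred_eq, hE, ← mul_sub, ← Finset.sum_sub_distrib,
          ← Real.norm_eq_abs, ← ENNReal.ofReal_le_ofReal_iff (norm_nonneg _),
          ENNReal.ofReal_toReal hηt, ofReal_norm]
    _ ≤ ENNReal.ofReal (Var[X; Measure.pi fun _ => F] / η.toReal ^ 2) :=
        meas_ge_le_variance_div_sq hX hc
    _ ≤ ENNReal.ofReal ((∫ x, f x ^ 2 ∂F) / η.toReal ^ 2) := by gcongr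
    _ = _ := by
        rw [ENNReal.ofReal_div_of_pos (by positivity), ENNReal.ofReal_pow hc.le,
          ENNReal.ofReal_toReal hηt,
          ofReal_integral_eq_lintegral_ofReal hf.integrable_sq (ae_of_all _ fun _ => sq_nonneg _)]
        congr 2
        ext x
        rw [← sq_abs, ENNReal.ofReal_pow (abs_nonneg _), ← Real.norm_eq_abs, ofReal_norm]

/-- A conditional Chebyshev inequality, given a random element `T`. -/
lemma measure_sum_sub_ge_le [IsProbabilityMeasure τ] {κ : Type*} [Fintype κ] {T : Ω → 𝒯} {g : Ω → κ → Z}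
    (hx : HasLaw (fun ω => (T ω, g ω)) (τ.prod (Measure.pi fun _ => F)) P)
    {h : 𝒯 × Z → ℝ} (hh : Measurable h) {n : ℕ} (hn : Fintype.card κ ≤ n) {η ε : ℝ≥0∞}
    (hη : 0 < η) (hηt : η ≠ ∞) :
    P {ω | η ≤ ‖(√(n : ℝ))⁻¹ * ∑ i, (h (T ω, g ω i) - ∫ y, h (T ω, y) ∂F)‖ₑ} ≤
      P {ω | ε ≤ ∫⁻ y, ‖h (T ω, y)‖ₑ ^ 2 ∂F} + ε / η ^ 2 := by
  have hG : Measurable fun t => ∫⁻ y, ‖h (t, y)‖ₑ ^ 2 ∂F :=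
    Measurable.lintegral_prod_right' (f := fun q => ‖h q‖ₑ ^ 2) (by fun_prop)
  -- Each slice of `U` at fixed `t` is either empty or subject to Chebyshev's inequality with second
  -- moment below `ε`; Fubini integrates these bounds over `t`.
  set U : Set (𝒯 × (κ → Z)) := {q | ∫⁻ y, ‖h (q.1, y)‖ₑ ^ 2 ∂F < ε ∧
    η ≤ ‖(√(n : ℝ))⁻¹ * ∑ i, (h (q.1, q.2 i) - ∫ y, h (q.1, y) ∂F)‖ₑ}
  have hI : Measurable fun t => ∫ y, h (t, y) ∂F :=
    (hh.stronglyMeasurable.integral_prod_right').measurable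
  have hU : MeasurableSet U := by
    have hS : Measurable fun q : 𝒯 × (κ → Z) =>
        ‖(√(n : ℝ))⁻¹ * ∑ i, (h (q.1, q.2 i) - ∫ y, h (q.1, y) ∂F)‖ₑ := by
      refine Measurable.enorm (Measurable.const_mul (Finset.measurable_fun_sum _ fun i _ => ?_) _)
      exact (hh.comp (by fun_prop)).sub (hI.comp measurable_fst)
    have hS' := hS (measurableSet_Ici (a := η))
    exact (measurableSet_lt (hG.comp measurable_fst) measurable_const).inter hS'
  calc _ ≤ P ({ω | ε ≤ ∫⁻ y, ‖h (T ω, y)‖ₑ ^ 2 ∂F} ∪ {ω | (T ω, g ω) ∈ U}) := by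
        refine measure_mono fun ω hω => ?_
        by_cases hT : ∫⁻ y, ‖h (T ω, y)‖ₑ ^ 2 ∂F < ε
        · exact Or.inr ⟨hT, hω⟩
        · exact Or.inl (not_lt.1 hT)
    _ ≤ _ := measure_union_le _ _
    _ ≤ _ := by
        gcongr
        rw [hx.measure_eq (p := fun q => q ∈ U) hU]
        change (τ.prod (Measure.pi fun _ => F)) U ≤ _
        rw [Measure.prod_apply hU]
        refine (lintegral_mono (g := fun _ => ε / η ^ 2) fun t => ?_).trans (by simp)
        by_cases ht : ∫⁻ y, ‖h (t, y)‖ₑ ^ 2 ∂F < ε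
        · have hf : MemLp (fun y => h (t, y)) 2 F := by
            refine ⟨(hh.comp measurable_prodMk_left).aestronglyMeasurable, ?_⟩
            rw [eLpNorm_lt_top_iff_lintegral_rpow_enorm_lt_top (by simp) (by simp)]
            simpa using ht.trans_le le_top
          calc _ ≤ _ := measure_mono fun y hy => hy.2
            _ ≤ _ := pi_measure_sum_sub_ge_le hf hn hη hηt
            _ ≤ _ := ENNReal.div_le_div_right ht.le _
        · have : Prod.mk t ⁻¹' U = ∅ := by
            ext y; simp only [U, Set.mem_preimage, Set.mem_ofPred_eq, ht, false_and]; rfl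
          simp [this]

/-- Replacing an almost everywhere measurable function by a measurable one. -/
lemma exists_measurable_modification {E : Type*} [MeasurableSpace E] {κ : Type*} [Finite κ]
    {T : Ω → 𝒯} {g : Ω → κ → Z} (hT : HasLaw T τ P)
    (hx : ∀ i, HasLaw (fun ω => (T ω, g ω i)) (τ.prod F) P)
    {h : 𝒯 × Z → E} (hh : AEMeasurable h (τ.prod F)) :
    ∃ h' : 𝒯 × Z → E, Measurable h' ∧ ∀ᵐ ω ∂P, ((fun y => h (T ω, y)) =ᵐ[F] fun y => h' (T ω, y)) ∧
      ∀ i, h (T ω, g ω i) = h' (T ω, g ω i) := by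
  refine ⟨hh.mk h, hh.measurable_mk, ?_⟩
  have h1 : ∀ᵐ t ∂(P.map T), (fun y => h (t, y)) =ᵐ[F] fun y => hh.mk h (t, y) := by
    rw [hT.map_eq]
    exact Measure.ae_ae_of_ae_prod hh.ae_eq_mk
  refine (ae_of_ae_map hT.aemeasurable h1).and (ae_all_iff.2 fun i => ?_)
  have h3 : ∀ᵐ q ∂(P.map fun ω => (T ω, g ω i)), h q = hh.mk h q := by
    rw [(hx i).map_eq]; exact hh.ae_eq_mk
  exact ae_of_ae_map (hx i).aemeasurable h3

end Conditional

lemma tendsto_vec_iff {α : Type*} {l : Filter α} {r : ℕ} {f : α → Vec r} {c : Vec r} :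
    Tendsto f l (𝓝 c) ↔ ∀ j, Tendsto (fun a => f a j) l (𝓝 (c j)) := by
  rw [← tendsto_pi_nhds (f := fun a j => f a j) (g := fun j => c j),
    (PiLp.homeomorph 2 fun _ : Fin r => ℝ).isInducing.tendsto_nhds_iff]
  rfl

lemma integral_vec_apply {Z : Type*} [MeasurableSpace Z] {F₀ : Measure Z} {r : ℕ} {f : Z → Vec r} (hf : Integrable f F₀) (j : Fin r) :
    (∫ y, f y ∂F₀) j = ∫ y, f y j ∂F₀ :=
  ((EuclideanSpace.proj (𝕜 := ℝ) j).integral_comp_comm hf).symm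

/-! ### Sums over a held-out group -/

namespace CrossFit

variable {Ω Z Γ Λ : Type*} {L : ℕ} (C : CrossFit Z Γ Λ L) (z : ℕ → Ω → Z)

/-- The observations outside group `ℓ`. -/
def train (n : ℕ) (ℓ : Fin L) (ω : Ω) : C.Train n ℓ := fun i => z i.1 ω

/-- The observations in group `ℓ`. -/
def heldOut (n : ℕ) (ℓ : Fin L) (ω : Ω) : {i : Fin n // ¬ C.fold n i ≠ ℓ} → Z := fun i => z i.1 ω

lemma sum_fold_eq {E : Type*} [AddCommMonoid E] (n : ℕ) (ℓ : Fin L) (f : Fin n → E) :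
    ∑ i : Fin n with C.fold n i = ℓ, f i = ∑ i : {i : Fin n // ¬ C.fold n i ≠ ℓ}, f i.1 :=
  Finset.sum_subtype _ (by simp) f

lemma sum_sum_fold {E : Type*} [AddCommMonoid E] (n : ℕ) (f : Fin n → E) :
    ∑ ℓ : Fin L, ∑ i : Fin n with C.fold n i = ℓ, f i = ∑ i : Fin n, f i :=
  Finset.sum_fiberwise _ _ _

lemma card_heldOut_le (n : ℕ) (ℓ : Fin L) :
    Fintype.card {i : Fin n // ¬ C.fold n i ≠ ℓ} ≤ n :=
  (Fintype.card_subtype_le _).trans (Fintype.card_fin n).le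

variable [MeasurableSpace Ω] [MeasurableSpace Z] {P : Measure Ω} {F₀ : Measure Z} {C z}
  [IsProbabilityMeasure F₀]

/-- This is what cross-fitting provides: splitting the coordinates of an i.i.d. sample leaves two
independent blocks, so first steps computed from one block may be held fixed while averaging over
the other. -/
lemma hasLaw_train_heldOut (hlaw : ∀ i, HasLaw (z i) F₀ P) (hindep : iIndepFun z P) (n : ℕ)
    (ℓ : Fin L) : HasLaw (fun ω => (C.train z n ℓ ω, C.heldOut z n ℓ ω))
      ((Measure.pi fun _ => F₀).prod (Measure.pi fun _ => F₀)) P := by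
  have h1 : HasLaw (fun ω (i : Fin n) => z i ω) (Measure.pi fun _ => F₀) P :=
    (hindep.precomp Fin.val_injective).hasLaw_pi fun i => hlaw i
  exact (measurePreserving_piEquivPiSubtypeProd (fun _ : Fin n => F₀)
    (fun i => C.fold n i ≠ ℓ)).fun_comp_hasLaw h1

lemma hasLaw_train (hlaw : ∀ i, HasLaw (z i) F₀ P) (hindep : iIndepFun z P) (n : ℕ) (ℓ : Fin L) :
    HasLaw (C.train z n ℓ) (Measure.pi fun _ => F₀) P :=
  measurePreserving_fst.fun_comp_hasLaw (hasLaw_train_heldOut hlaw hindep n ℓ)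

lemma hasLaw_train_prodMk (hlaw : ∀ i, HasLaw (z i) F₀ P) (hindep : iIndepFun z P) (n : ℕ)
    (ℓ : Fin L) (i : {i : Fin n // ¬ C.fold n i ≠ ℓ}) :
    HasLaw (fun ω => (C.train z n ℓ ω, C.heldOut z n ℓ ω i)) (C.jointLaw F₀ n ℓ) P :=
  ((MeasurePreserving.id _).prod (measurePreserving_eval _ i)).fun_comp_hasLaw
    (hasLaw_train_heldOut hlaw hindep n ℓ)

/-- The functions at the true first steps are only almost everywhere measurable. A null set of the
product law is invisible both to almost every training sample and to the realized pairs, so a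
measurable version may replace them. -/
lemma exists_modification (hlaw : ∀ i, HasLaw (z i) F₀ P) (hindep : iIndepFun z P) {ℓ : Fin L}
    {E : Type*} [MeasurableSpace E]
    {h : ∀ n, C.Train n ℓ × Z → E} (hh : ∀ n, AEMeasurable (h n) (C.jointLaw F₀ n ℓ)) :
    ∃ h' : ∀ n, C.Train n ℓ × Z → E, (∀ n, Measurable (h' n)) ∧
      ∀ᶠ q in probFilter P, ((fun y => h q.1 (C.train z q.1 ℓ q.2, y)) =ᵐ[F₀]
        fun y => h' q.1 (C.train z q.1 ℓ q.2, y)) ∧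
        ∀ i : {i : Fin q.1 // ¬ C.fold q.1 i ≠ ℓ},
          h q.1 (C.train z q.1 ℓ q.2, z i.1 q.2) = h' q.1 (C.train z q.1 ℓ q.2, z i.1 q.2) := by
  choose h' hm hae using fun n => exists_measurable_modification (hasLaw_train hlaw hindep n ℓ)
    (hasLaw_train_prodMk hlaw hindep n ℓ) (hh n)
  exact ⟨h', hm, eventually_probFilter_of_ae hae⟩

/-- Averages over a group converge to zero in probability if the conditional means do. -/
lemma tendsto_avg (hlaw : ∀ i, HasLaw (z i) F₀ P) (hindep : iIndepFun z P) {ℓ : Fin L}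
    {h : ∀ n, C.Train n ℓ × Z → ℝ≥0∞} (hh : ∀ n, AEMeasurable (h n) (C.jointLaw F₀ n ℓ))
    (hlim : Tendsto (fun q : ℕ × Ω => ∫⁻ y, h q.1 (C.train z q.1 ℓ q.2, y) ∂F₀)
      (probFilter P) (𝓝 0)) :
    Tendsto (fun q : ℕ × Ω => (q.1 : ℝ≥0∞)⁻¹ *
      ∑ i : Fin q.1 with C.fold q.1 i = ℓ, h q.1 (C.train z q.1 ℓ q.2, z i q.2))
      (probFilter P) (𝓝 0) := by
  obtain ⟨h', hm, hae⟩ := exists_modification hlaw hindep hh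
  have hlim' : Tendsto (fun q : ℕ × Ω => ∫⁻ y, h' q.1 (C.train z q.1 ℓ q.2, y) ∂F₀)
      (probFilter P) (𝓝 0) := hlim.congr' (hae.mono fun q hq => lintegral_congr_ae hq.1)
  have key := tendsto_zero_of_le_add (P := P) (c := id)
    (X := fun q : ℕ × Ω => (q.1 : ℝ≥0∞)⁻¹ * ∑ i : {i : Fin q.1 // ¬ C.fold q.1 i ≠ ℓ},
      h' q.1 (C.train z q.1 ℓ q.2, z i.1 q.2)) (fun _ h _ => h) hlim'
    fun n η ε hη hηt _ _ => measure_avg_ge_le (hasLaw_train_prodMk hlaw hindep n ℓ) (hm n)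
      (C.card_heldOut_le n ℓ) hη hηt
  refine key.congr' (hae.mono fun q hq => ?_)
  simp only [sum_fold_eq, hq.2]

/-- Normalized centered sums over a group converge to zero in probability if the conditional second
moments do. -/
lemma tendsto_sum_sub_real (hlaw : ∀ i, HasLaw (z i) F₀ P) (hindep : iIndepFun z P) {ℓ : Fin L}
    {h : ∀ n, C.Train n ℓ × Z → ℝ} (hh : ∀ n, AEMeasurable (h n) (C.jointLaw F₀ n ℓ))
    (hlim : Tendsto (fun q : ℕ × Ω => ∫⁻ y, ‖h q.1 (C.train z q.1 ℓ q.2, y)‖ₑ ^ 2 ∂F₀)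
      (probFilter P) (𝓝 0)) :
    Tendsto (fun q : ℕ × Ω => (√(q.1 : ℝ))⁻¹ *
      ∑ i : Fin q.1 with C.fold q.1 i = ℓ, (h q.1 (C.train z q.1 ℓ q.2, z i q.2)
        - ∫ y, h q.1 (C.train z q.1 ℓ q.2, y) ∂F₀))
      (probFilter P) (𝓝 0) := by
  obtain ⟨h', hm, hae⟩ := exists_modification hlaw hindep hh
  have hlim' : Tendsto (fun q : ℕ × Ω => ∫⁻ y, ‖h' q.1 (C.train z q.1 ℓ q.2, y)‖ₑ ^ 2 ∂F₀)
      (probFilter P) (𝓝 0) := hlim.congr' (hae.mono fun q hq => lintegral_congr_ae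
        (hq.1.mono fun y hy => by simp only [hy]))
  have key := tendsto_zero_of_le_add (P := P) (c := fun η => η ^ 2)
    (X := fun q : ℕ × Ω => ‖(√(q.1 : ℝ))⁻¹ * ∑ i : {i : Fin q.1 // ¬ C.fold q.1 i ≠ ℓ},
      (h' q.1 (C.train z q.1 ℓ q.2, z i.1 q.2) - ∫ y, h' q.1 (C.train z q.1 ℓ q.2, y) ∂F₀)‖ₑ)
    (fun _ h _ => ENNReal.pow_pos h 2) hlim'
    fun n η ε hη hηt _ _ => measure_sum_sub_ge_le (hasLaw_train_heldOut hlaw hindep n ℓ) (hm n)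
      (C.card_heldOut_le n ℓ) hη hηt
  rw [tendsto_zero_iff_enorm_tendsto_zero]
  refine key.congr' (hae.mono fun q hq => ?_)
  simp only [sum_fold_eq, hq.2, integral_congr_ae hq.1]

lemma eventually_memLp (hlaw : ∀ i, HasLaw (z i) F₀ P) (hindep : iIndepFun z P) {ℓ : Fin L} {r : ℕ}
    {h : ∀ n, C.Train n ℓ × Z → Vec r} (hh : ∀ n, AEMeasurable (h n) (C.jointLaw F₀ n ℓ))
    (hlim : Tendsto (fun q : ℕ × Ω => ∫⁻ y, ‖h q.1 (C.train z q.1 ℓ q.2, y)‖ₑ ^ 2 ∂F₀)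
      (probFilter P) (𝓝 0)) :
    ∀ᶠ q in probFilter P, MemLp (fun y => h q.1 (C.train z q.1 ℓ q.2, y)) 2 F₀ := by
  obtain ⟨h', hm, hae⟩ := exists_modification hlaw hindep hh
  filter_upwards [hae, hlim.eventually (gt_mem_nhds zero_lt_one)] with q hq hq1
  refine ⟨⟨_, ((hm q.1).comp measurable_prodMk_left).stronglyMeasurable, hq.1⟩, ?_⟩
  rw [eLpNorm_lt_top_iff_lintegral_rpow_enorm_lt_top (by simp) (by simp)]
  simpa using hq1.trans_le le_top

lemma tendsto_sum_sub (hlaw : ∀ i, HasLaw (z i) F₀ P) (hindep : iIndepFun z P) {ℓ : Fin L} {r : ℕ}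
    {h : ∀ n, C.Train n ℓ × Z → Vec r} (hh : ∀ n, AEMeasurable (h n) (C.jointLaw F₀ n ℓ))
    (hlim : Tendsto (fun q : ℕ × Ω => ∫⁻ y, ‖h q.1 (C.train z q.1 ℓ q.2, y)‖ₑ ^ 2 ∂F₀)
      (probFilter P) (𝓝 0)) :
    Tendsto (fun q : ℕ × Ω => (√(q.1 : ℝ))⁻¹ •
      ∑ i : Fin q.1 with C.fold q.1 i = ℓ, (h q.1 (C.train z q.1 ℓ q.2, z i q.2)
        - ∫ y, h q.1 (C.train z q.1 ℓ q.2, y) ∂F₀))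
      (probFilter P) (𝓝 0) := by
  rw [tendsto_vec_iff]
  intro j
  have hj := tendsto_sum_sub_real hlaw hindep (h := fun n q => h n q j)
    (fun n => (EuclideanSpace.proj (𝕜 := ℝ) j).continuous.measurable.comp_aemeasurable (hh n))
    (tendsto_of_tendsto_of_tendsto_of_le_of_le tendsto_const_nhds hlim (fun _ => zero_le)
      fun q => lintegral_mono fun y => by
        gcongr
        rw [enorm_le_iff_norm_le]
        exact PiLp.norm_apply_le _ _)
  refine hj.congr' ((eventually_memLp hlaw hindep hh hlim).mono fun q hq => ?_)
  simp [integral_vec_apply (hq.integrable one_le_two)]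

end CrossFit

/-! ### Expansion of the sample moments in the first steps -/

namespace CrossFit

variable {Ω Z Γ Λ : Type*} {L p r : ℕ} (C : CrossFit Z Γ Λ L) (z : ℕ → Ω → Z)
  (S : MomentModel Z Γ Λ p r)

/-- The effect of the estimated `γ̂_ℓ` on the original moment function. -/
def mDiff (ℓ : Fin L) (n : ℕ) (q : C.Train n ℓ × Z) : Vec r :=
  S.m q.2 S.β₀ (C.gammaHat n ℓ q.1) - S.m q.2 S.β₀ S.γ₀

/-- The effect of the estimated `γ̂_ℓ` on the adjustment term. -/
def gamDiff (ℓ : Fin L) (n : ℕ) (q : C.Train n ℓ × Z) : Vec r :=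
  S.φ q.2 S.β₀ (C.gammaHat n ℓ q.1) S.lam₀ - S.φ q.2 S.β₀ S.γ₀ S.lam₀

/-- The effect of the estimated `λ̂_ℓ` on the adjustment term. -/
def lamDiff (ℓ : Fin L) (n : ℕ) (q : C.Train n ℓ × Z) : Vec r :=
  S.φ q.2 S.β₀ S.γ₀ (C.lamHat n ℓ q.1) - S.φ q.2 S.β₀ S.γ₀ S.lam₀

/-- The interaction of the two estimated first steps. -/
def interaction (ℓ : Fin L) (n : ℕ) (q : C.Train n ℓ × Z) : Vec r :=
  S.φ q.2 S.β₀ (C.gammaHat n ℓ q.1) (C.lamHat n ℓ q.1)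
    - S.φ q.2 S.β₀ S.γ₀ (C.lamHat n ℓ q.1)
    - S.φ q.2 S.β₀ (C.gammaHat n ℓ q.1) S.lam₀
    + S.φ q.2 S.β₀ S.γ₀ S.lam₀

lemma gam_eq (n : ℕ) (ℓ : Fin L) (ω : Ω) :
    C.gam z n ℓ ω = C.gammaHat n ℓ (C.train z n ℓ ω) := rfl

lemma lam_eq (n : ℕ) (ℓ : Fin L) (ω : Ω) :
    C.lam z n ℓ ω = C.lamHat n ℓ (C.train z n ℓ ω) := rfl

/-- An exact identity, with no Taylor expansion in the first steps: whatever is not a one-at-a-time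
effect is put in the interaction. -/
lemma psi_eq_add_diffs (ℓ : Fin L) (n : ℕ) (ω : Ω) (x : Z) :
    S.ψ x S.β₀ (C.gam z n ℓ ω) (C.lam z n ℓ ω) =
      S.ψ₀ x + (C.mDiff S ℓ n (C.train z n ℓ ω, x) + C.gamDiff S ℓ n (C.train z n ℓ ω, x)
        + C.lamDiff S ℓ n (C.train z n ℓ ω, x) + C.interaction S ℓ n (C.train z n ℓ ω, x)) := by
  simp only [MomentModel.ψ₀, MomentModel.ψ, mDiff, gamDiff, lamDiff, interaction, gam_eq, lam_eq]
  abel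

lemma tendsto_group_size_smul [MeasurableSpace Ω] {P : Measure Ω} {E : Type*} [NormedAddCommGroup E] [NormedSpace ℝ E]
    {v : ℕ × Ω → E} (hv : Tendsto (fun q => √(q.1 : ℝ) • v q) (probFilter P) (𝓝 0)) (ℓ : Fin L) :
    Tendsto (fun q => (√(q.1 : ℝ))⁻¹ • ∑ _i : Fin q.1 with C.fold q.1 _i = ℓ, v q)
      (probFilter P) (𝓝 0) := by
  refine squeeze_zero_norm (fun q => ?_) (tendsto_zero_iff_norm_tendsto_zero.1 hv)
  rw [Finset.sum_const, ← Nat.cast_smul_eq_nsmul ℝ, smul_smul, norm_smul, norm_smul]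
  gcongr
  rw [Real.norm_of_nonneg (by positivity), Real.norm_of_nonneg (by positivity)]
  calc (√(q.1 : ℝ))⁻¹ * _ ≤ (√(q.1 : ℝ))⁻¹ * q.1 := by
        gcongr
        exact (Finset.card_le_univ _).trans (Fintype.card_fin _).le
    _ = √(q.1 : ℝ) := by rw [inv_mul_eq_div, Real.div_sqrt]

variable [MeasurableSpace Ω] [MeasurableSpace Z] {P : Measure Ω} {F₀ : Measure Z} {C z S}

lemma aemeasurable_mDiff (hmeas : C.JointlyMeasurable S F₀) (hzero : S.MeanZero F₀) (ℓ : Fin L)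
    (n : ℕ) : AEMeasurable (C.mDiff S ℓ n) (C.jointLaw F₀ n ℓ) :=
  (hmeas.m_hat n ℓ).aemeasurable.sub hzero.integrable_m.aestronglyMeasurable.aemeasurable.comp_snd

lemma aemeasurable_gamDiff (hmeas : C.JointlyMeasurable S F₀) (hzero : S.MeanZero F₀) (ℓ : Fin L)
    (n : ℕ) : AEMeasurable (C.gamDiff S ℓ n) (C.jointLaw F₀ n ℓ) :=
  (hmeas.phi_gam n ℓ).aemeasurable.sub
    hzero.integrable_phi.aestronglyMeasurable.aemeasurable.comp_snd

lemma aemeasurable_lamDiff (hmeas : C.JointlyMeasurable S F₀) (hzero : S.MeanZero F₀) (ℓ : Fin L)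
    (n : ℕ) : AEMeasurable (C.lamDiff S ℓ n) (C.jointLaw F₀ n ℓ) :=
  (hmeas.phi_lam n ℓ).aemeasurable.sub
    hzero.integrable_phi.aestronglyMeasurable.aemeasurable.comp_snd

lemma aemeasurable_interaction (hmeas : C.JointlyMeasurable S F₀) (hzero : S.MeanZero F₀)
    (ℓ : Fin L) (n : ℕ) : AEMeasurable (C.interaction S ℓ n) (C.jointLaw F₀ n ℓ) :=
  (((hmeas.phi_hat n ℓ).sub (hmeas.phi_lam n ℓ)).sub (hmeas.phi_gam n ℓ)).aemeasurable.add
    hzero.integrable_phi.aestronglyMeasurable.aemeasurable.comp_snd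

variable [IsProbabilityMeasure F₀]

/-- If `m` does not depend on the observation, the difference is constant in it and the centered sum
vanishes identically; otherwise mean-square consistency applies. -/
lemma mDiff_centered (hlaw : ∀ i, HasLaw (z i) F₀ P) (hindep : iIndepFun z P)
    (hmeas : C.JointlyMeasurable S F₀) (hzero : S.MeanZero F₀)
    (hms : C.MeanSquareConsistent z S F₀ P) (ℓ : Fin L) :
    (∀ᶠ q in probFilter P, Integrable (fun y => C.mDiff S ℓ q.1 (C.train z q.1 ℓ q.2, y)) F₀) ∧
    Tendsto (fun q : ℕ × Ω => (√(q.1 : ℝ))⁻¹ •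
      ∑ i : Fin q.1 with C.fold q.1 i = ℓ, (C.mDiff S ℓ q.1 (C.train z q.1 ℓ q.2, z i q.2)
        - ∫ y, C.mDiff S ℓ q.1 (C.train z q.1 ℓ q.2, y) ∂F₀)) (probFilter P) (𝓝 0) := by
  rcases hms.m_conv ℓ with h | h
  · have hc : ∀ q : ℕ × Ω, ∀ x, (fun y => C.mDiff S ℓ q.1 (C.train z q.1 ℓ q.2, y)) =
        fun _ => C.mDiff S ℓ q.1 (C.train z q.1 ℓ q.2, x) := fun q x => by
      ext1 y; simp only [mDiff, h _ y x]
    refine ⟨Eventually.of_forall fun q => ?_, tendsto_const_nhds.congr fun q => ?_⟩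
    · have hne : Nonempty Z := nonempty_of_isProbabilityMeasure F₀
      rw [hc q hne.some]
      exact integrable_const _
    · rw [Finset.sum_eq_zero, smul_zero]
      intro i _
      rw [hc q (z i q.2)]
      simp
  · have hlim := tendstoZeroInProb_iff.1 h
    exact ⟨(eventually_memLp hlaw hindep (aemeasurable_mDiff hmeas hzero ℓ) hlim).mono
      fun q hq => hq.integrable one_le_two,
      tendsto_sum_sub hlaw hindep (aemeasurable_mDiff hmeas hzero ℓ) hlim⟩

lemma gamDiff_centered (hlaw : ∀ i, HasLaw (z i) F₀ P) (hindep : iIndepFun z P)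
    (hmeas : C.JointlyMeasurable S F₀) (hzero : S.MeanZero F₀)
    (hms : C.MeanSquareConsistent z S F₀ P) (ℓ : Fin L) :
    (∀ᶠ q in probFilter P, Integrable (fun y => C.gamDiff S ℓ q.1 (C.train z q.1 ℓ q.2, y)) F₀) ∧
    Tendsto (fun q : ℕ × Ω => (√(q.1 : ℝ))⁻¹ •
      ∑ i : Fin q.1 with C.fold q.1 i = ℓ, (C.gamDiff S ℓ q.1 (C.train z q.1 ℓ q.2, z i q.2)
        - ∫ y, C.gamDiff S ℓ q.1 (C.train z q.1 ℓ q.2, y) ∂F₀)) (probFilter P) (𝓝 0) := by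
  have hlim := tendstoZeroInProb_iff.1 (hms.phi_gam_conv ℓ)
  exact ⟨(eventually_memLp hlaw hindep (aemeasurable_gamDiff hmeas hzero ℓ) hlim).mono
    fun q hq => hq.integrable one_le_two,
    tendsto_sum_sub hlaw hindep (aemeasurable_gamDiff hmeas hzero ℓ) hlim⟩

lemma lamDiff_centered (hlaw : ∀ i, HasLaw (z i) F₀ P) (hindep : iIndepFun z P)
    (hmeas : C.JointlyMeasurable S F₀) (hzero : S.MeanZero F₀)
    (hms : C.MeanSquareConsistent z S F₀ P) (ℓ : Fin L) :
    (∀ᶠ q in probFilter P, Integrable (fun y => C.lamDiff S ℓ q.1 (C.train z q.1 ℓ q.2, y)) F₀) ∧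
    Tendsto (fun q : ℕ × Ω => (√(q.1 : ℝ))⁻¹ •
      ∑ i : Fin q.1 with C.fold q.1 i = ℓ, (C.lamDiff S ℓ q.1 (C.train z q.1 ℓ q.2, z i q.2)
        - ∫ y, C.lamDiff S ℓ q.1 (C.train z q.1 ℓ q.2, y) ∂F₀)) (probFilter P) (𝓝 0) := by
  have hlim := tendstoZeroInProb_iff.1 (hms.phi_lam_conv ℓ)
  exact ⟨(eventually_memLp hlaw hindep (aemeasurable_lamDiff hmeas hzero ℓ) hlim).mono
    fun q hq => hq.integrable one_le_two,
    tendsto_sum_sub hlaw hindep (aemeasurable_lamDiff hmeas hzero ℓ) hlim⟩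

/-- The effects of `γ̂` on `m` and on `φ` are kept together, since only their sum, which is `ψ̄(γ̂,
λ₀)` by the zero means at the truth, is assumed to be small. -/
lemma tendsto_mean_gamma (hlaw : ∀ i, HasLaw (z i) F₀ P) (hindep : iIndepFun z P)
    (hmeas : C.JointlyMeasurable S F₀) (hzero : S.MeanZero F₀)
    (hms : C.MeanSquareConsistent z S F₀ P) (hrate : C.RateConditions z S F₀ P) (ℓ : Fin L) :
    Tendsto (fun q : ℕ × Ω => √(q.1 : ℝ) •
      (∫ y, C.mDiff S ℓ q.1 (C.train z q.1 ℓ q.2, y) ∂F₀ +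
        ∫ y, C.gamDiff S ℓ q.1 (C.train z q.1 ℓ q.2, y) ∂F₀)) (probFilter P) (𝓝 0) := by
  refine (tendstoInMeasure_const_iff.1 (hrate.psiBar_conv ℓ)).congr' ?_
  filter_upwards [(mDiff_centered hlaw hindep hmeas hzero hms ℓ).1,
    (gamDiff_centered hlaw hindep hmeas hzero hms ℓ).1] with q h1 h2
  congr 1
  have h3 : (fun y => S.ψ y S.β₀ (C.gam z q.1 ℓ q.2) S.lam₀) = fun y =>
      (C.mDiff S ℓ q.1 (C.train z q.1 ℓ q.2, y) + C.gamDiff S ℓ q.1 (C.train z q.1 ℓ q.2, y)) +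
        (S.m y S.β₀ S.γ₀ + S.φ y S.β₀ S.γ₀ S.lam₀) := by
    ext1 y
    simp only [MomentModel.ψ, mDiff, gamDiff, gam_eq]
    abel
  rw [MomentModel.psiBar, h3,
    integral_add (f := fun y => _ + _) (g := fun y => _ + _) (h1.add h2)
      (hzero.integrable_m.add hzero.integrable_phi),
    integral_add h1 h2, integral_add hzero.integrable_m hzero.integrable_phi, hzero.integral_m,
    hzero.integral_phi, add_zero, add_zero]

lemma tendsto_mean_lambda (hlaw : ∀ i, HasLaw (z i) F₀ P) (hindep : iIndepFun z P)
    (hmeas : C.JointlyMeasurable S F₀) (hzero : S.MeanZero F₀)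
    (hms : C.MeanSquareConsistent z S F₀ P) (hrate : C.RateConditions z S F₀ P) (ℓ : Fin L) :
    Tendsto (fun q : ℕ × Ω => √(q.1 : ℝ) •
      (∫ y, C.lamDiff S ℓ q.1 (C.train z q.1 ℓ q.2, y) ∂F₀)) (probFilter P) (𝓝 0) := by
  refine (tendstoInMeasure_const_iff.1 (hrate.phiBar_conv ℓ)).congr' ?_
  filter_upwards [(lamDiff_centered hlaw hindep hmeas hzero hms ℓ).1] with q h1
  congr 1
  have h3 : (fun y => S.φ y S.β₀ S.γ₀ (C.lam z q.1 ℓ q.2)) = fun y =>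
      C.lamDiff S ℓ q.1 (C.train z q.1 ℓ q.2, y) + S.φ y S.β₀ S.γ₀ S.lam₀ := by
    ext1 y
    simp only [lamDiff, lam_eq]
    abel
  rw [MomentModel.phiBar, h3, integral_add h1 hzero.integrable_phi, hzero.integral_phi, add_zero]

/-- `R̂₂` is the sum over all groups, so its convergence settles every group at once. If it fails,
each group must satisfy the integral condition, and the conditional Markov inequality applies to
`√n` times the largest coordinate; no centering is needed. -/
lemma tendsto_interaction (hlaw : ∀ i, HasLaw (z i) F₀ P) (hindep : iIndepFun z P)
    (hmeas : C.JointlyMeasurable S F₀) (hzero : S.MeanZero F₀)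
    (hrem : C.SecondOrderRemainder z S F₀ P) :
    Tendsto (fun q : ℕ × Ω => (√(q.1 : ℝ))⁻¹ • ∑ ℓ : Fin L,
      ∑ i : Fin q.1 with C.fold q.1 i = ℓ, C.interaction S ℓ q.1 (C.train z q.1 ℓ q.2, z i q.2))
      (probFilter P) (𝓝 0) := by
  by_cases hR : TendstoInMeasure P (fun (n : ℕ) ω => C.R₂ z S n ω) atTop fun _ => 0
  · refine (tendstoInMeasure_const_iff.1 hR).congr fun q => ?_
    simp only [R₂]
    congr 1
    refine Finset.sum_congr rfl fun ℓ _ => Finset.sum_congr rfl fun i _ => ?_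
    simp only [interaction, gam_eq, lam_eq]
    abel
  · simp_rw [Finset.smul_sum (s := (Finset.univ : Finset (Fin L)))]
    rw [← Finset.sum_const_zero (s := (Finset.univ : Finset (Fin L)))]
    refine tendsto_finsetSum _ fun ℓ _ => ?_
    have hlim := tendstoZeroInProb_iff.1 ((hrem ℓ).resolve_right hR)
    have hlim' := hlim.congr fun q : ℕ × Ω => (lintegral_const_mul' (μ := F₀)
      (ENNReal.ofReal √(q.1 : ℝ)) _ ENNReal.ofReal_ne_top).symm
    have key := tendsto_avg hlaw hindep (ℓ := ℓ)
      (h := fun n q => ENNReal.ofReal √(n : ℝ) * ⨆ j, ‖C.interaction S ℓ n q j‖ₑ) (fun n => by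
        refine AEMeasurable.const_mul (AEMeasurable.iSup fun j => AEMeasurable.enorm ?_) _
        exact (EuclideanSpace.proj (𝕜 := ℝ) j).continuous.measurable.comp_aemeasurable
          (aemeasurable_interaction hmeas hzero ℓ n)) hlim'
    rw [tendsto_vec_iff]
    intro j
    rw [PiLp.zero_apply, tendsto_zero_iff_enorm_tendsto_zero]
    refine tendsto_of_tendsto_of_tendsto_of_le_of_le tendsto_const_nhds key (fun _ => zero_le)
      fun q => ?_
    have hs : ((q.1 : ℝ≥0∞))⁻¹ * ENNReal.ofReal √(q.1 : ℝ) = ‖(√(q.1 : ℝ))⁻¹‖ₑ ∨ q.1 = 0 := by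
      rcases Nat.eq_zero_or_pos q.1 with h0 | h0
      · exact Or.inr h0
      · left
        have h0' : (0 : ℝ) < q.1 := by exact_mod_cast h0
        rw [← ofReal_norm, Real.norm_of_nonneg (by positivity), ← ENNReal.ofReal_natCast,
          ← ENNReal.ofReal_inv_of_pos h0', ← ENNReal.ofReal_mul (by positivity), inv_mul_eq_div,
          Real.sqrt_div_self]
    rcases hs with hs | hs
    · rw [← Finset.mul_sum, ← mul_assoc, hs, PiLp.smul_apply, smul_eq_mul, enorm_mul]
      gcongr
      rw [WithLp.ofLp_sum, Finset.sum_apply]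
      refine (enorm_sum_le _ _).trans (Finset.sum_le_sum fun i _ => ?_)
      exact le_iSup (fun j => ‖C.interaction S ℓ q.1 (C.train z q.1 ℓ q.2, z i q.2) j‖ₑ) j
    · simp [hs]

/-- The sample moments at `β₀` are asymptotically equivalent to those at the true first steps. -/
theorem tendsto_psiHat_sub (hlaw : ∀ i, HasLaw (z i) F₀ P) (hindep : iIndepFun z P)
    (hmeas : C.JointlyMeasurable S F₀) (hzero : S.MeanZero F₀)
    (hms : C.MeanSquareConsistent z S F₀ P) (hrem : C.SecondOrderRemainder z S F₀ P)
    (hrate : C.RateConditions z S F₀ P) :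
    Tendsto (fun q : ℕ × Ω => √(q.1 : ℝ) • C.psiHat z S q.1 S.β₀ q.2 -
      (√(q.1 : ℝ))⁻¹ • ∑ i : Fin q.1, S.ψ₀ (z i q.2)) (probFilter P) (𝓝 0) := by
  have hgroup := tendsto_finsetSum (Finset.univ : Finset (Fin L)) fun ℓ _ =>
    ((((mDiff_centered hlaw hindep hmeas hzero hms ℓ).2.add
      (gamDiff_centered hlaw hindep hmeas hzero hms ℓ).2).add
      (lamDiff_centered hlaw hindep hmeas hzero hms ℓ).2).add
      (C.tendsto_group_size_smul
        (tendsto_mean_gamma hlaw hindep hmeas hzero hms hrate ℓ) ℓ)).add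
      (C.tendsto_group_size_smul
        (tendsto_mean_lambda hlaw hindep hmeas hzero hms hrate ℓ) ℓ)
  have key := hgroup.add (tendsto_interaction hlaw hindep hmeas hzero hrem)
  simp only [add_zero, Finset.sum_const_zero] at key
  refine key.congr fun q => ?_
  have hs : √(q.1 : ℝ) * (q.1 : ℝ)⁻¹ = (√(q.1 : ℝ))⁻¹ := by
    rw [← div_eq_mul_inv, Real.sqrt_div_self]
  simp only [psiHat]
  rw [smul_smul, hs, ← smul_sub]
  simp only [← smul_add, ← Finset.smul_sum]
  congr 1
  rw [← C.sum_sum_fold q.1 fun i => S.ψ₀ (z i q.2), ← Finset.sum_sub_distrib,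
    ← Finset.sum_add_distrib]
  refine Finset.sum_congr rfl fun ℓ _ => ?_
  simp only [← Finset.sum_add_distrib, ← Finset.sum_sub_distrib]
  refine Finset.sum_congr rfl fun i _ => ?_
  rw [psi_eq_add_diffs]
  abel

end CrossFit

/-! ### First order condition and mean value expansion -/

section Deterministic

variable {p r : ℕ}

lemma jacobian_apply (f : Vec p → Vec r) (β : Vec p) (j : Fin r) (k : Fin p) :
    jacobian f β j k = (fderiv ℝ f β (EuclideanSpace.single k 1)) j := rfl

lemma jacobian_mulVec (f : Vec p → Vec r) (β v : Vec p) :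
    jacobian f β *ᵥ v.ofLp = (fderiv ℝ f β v).ofLp := by
  have hv : v = ∑ k, v k • EuclideanSpace.single k (1 : ℝ) := by
    ext j
    simp [Finset.sum_apply, Pi.single_apply]
  ext j
  conv_rhs => rw [hv, map_sum]
  simp [Matrix.mulVec, dotProduct, jacobian_apply, Finset.sum_apply, mul_comm]

lemma abs_jacobian_sub_le (f : Vec p → Vec r) (β β' : Vec p) (j : Fin r) (k : Fin p) :
    |jacobian f β j k - jacobian f β' j k| ≤ ‖fderiv ℝ f β - fderiv ℝ f β'‖ := by
  have h : jacobian f β j k - jacobian f β' j k =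
      ((fderiv ℝ f β - fderiv ℝ f β') (EuclideanSpace.single k 1)) j := by
    simp [jacobian_apply]
  rw [h, ← Real.norm_eq_abs]
  refine (PiLp.norm_apply_le _ j).trans ((ContinuousLinearMap.le_opNorm _ _).trans ?_)
  simp

/-- The first order condition for a minimizer of a quadratic form of moments. -/
lemma jacobian_transpose_mulVec_eq_zero {f : Vec p → Vec r} {b : Vec p} (hf : DifferentiableAt ℝ f b)
    {W : Matrix (Fin r) (Fin r) ℝ} (hW : Wᵀ = W)
    (hmin : IsLocalMin (fun β => (f β).ofLp ⬝ᵥ (W *ᵥ (f β).ofLp)) b) :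
    (jacobian f b)ᵀ *ᵥ (W *ᵥ (f b).ofLp) = 0 := by
  ext k
  have hj : ∀ j, HasFDerivAt (fun β => (f β).ofLp j)
      ((EuclideanSpace.proj (𝕜 := ℝ) j).comp (fderiv ℝ f b)) b := fun j =>
    (EuclideanSpace.proj (𝕜 := ℝ) j).hasFDerivAt.comp b hf.hasFDerivAt
  have hg := HasFDerivAt.fun_sum (u := Finset.univ) fun j (_ : j ∈ Finset.univ) =>
    (hj j).mul (HasFDerivAt.fun_sum (u := Finset.univ) fun l (_ : l ∈ Finset.univ) =>
      (hj l).const_mul (W j l))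
  have h0 := hmin.hasFDerivAt_eq_zero hg
  have h1 := congrArg (fun A : Vec p →L[ℝ] ℝ => A (EuclideanSpace.single k 1)) h0
  simp only [_root_.sum_apply, _root_.add_apply, _root_.smul_apply,
    ContinuousLinearMap.comp_apply, _root_.zero_apply, smul_eq_mul, Finset.sum_add_distrib] at h1
  change ∑ j, (f b) j * ∑ l, W j l * jacobian f b l k +
    ∑ j, (∑ l, W j l * (f b) l) * jacobian f b j k = 0 at h1
  -- Symmetry of `W` makes the two halves of the product rule equal, so each of them vanishes.
  have h2 : ∑ j, (f b) j * ∑ l, W j l * jacobian f b l k =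
      ∑ j, (∑ l, W j l * (f b) l) * jacobian f b j k := by
    simp_rw [Finset.mul_sum, Finset.sum_mul]
    rw [Finset.sum_comm]
    refine Finset.sum_congr rfl fun l _ => Finset.sum_congr rfl fun j _ => ?_
    rw [show W j l = W l j from congrFun (congrFun hW l) j]
    ring
  rw [h2] at h1
  simp only [Matrix.mulVec, dotProduct, Matrix.transpose_apply, Pi.zero_apply]
  calc _ = ∑ j, (∑ l, W j l * (f b) l) * jacobian f b j k :=
        Finset.sum_congr rfl fun j _ => mul_comm _ _
    _ = 0 := by linarith

/-- A mean value expansion in which the remainder is absorbed into the Jacobian matrix. -/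
lemma exists_mean_value_matrix {f : Vec p → Vec r} {b₀ b : Vec p} {ρ K ζ : ℝ} (hb : b ∈ Metric.ball b₀ ρ)
    (hK : 0 ≤ K) (hζ : 0 < ζ) (hf : ∀ β ∈ Metric.ball b₀ ρ, DifferentiableAt ℝ f β ∧
      ‖fderiv ℝ f β - fderiv ℝ f b₀‖ ≤ K * ‖β - b₀‖ ^ ζ) :
    ∃ H : Matrix (Fin r) (Fin p) ℝ,
      (∀ j k, |H j k - jacobian f b₀ j k| ≤ K * ‖b - b₀‖ ^ ζ) ∧
      (f b).ofLp = (f b₀).ofLp + H *ᵥ (b - b₀).ofLp := by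
  have hsub : Metric.closedBall b₀ ‖b - b₀‖ ⊆ Metric.ball b₀ ρ := by
    refine Metric.closedBall_subset_ball ?_
    rwa [← mem_ball_iff_norm]
  set Δ := b - b₀ with hΔ
  set e : Vec r := f b - f b₀ - fderiv ℝ f b₀ Δ with he
  have hbound : ‖e‖ ≤ K * ‖Δ‖ ^ ζ * ‖Δ‖ := by
    refine (convex_closedBall b₀ ‖Δ‖).norm_image_sub_le_of_norm_hasFDerivWithin_le'
      (f' := fun β => fderiv ℝ f β)
      (fun β hβ => ((hf β (hsub hβ)).1.hasFDerivAt).hasFDerivWithinAt) (fun β hβ => ?_)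
      (Metric.mem_closedBall_self (norm_nonneg _)) (by simp [hΔ, dist_eq_norm])
    refine (hf β (hsub hβ)).2.trans ?_
    gcongr
    rwa [← mem_closedBall_iff_norm]
  -- The rank one matrix `e Δᵀ / ‖Δ‖²` sends `Δ` to the remainder `e`, and its entries are at most
  -- `‖e‖ / ‖Δ‖`. This avoids a separate intermediate point for each row. If `Δ = 0`, then `e = 0`
  -- and the inverse is zero by convention.
  refine ⟨jacobian f b₀ + Matrix.of fun j k => (‖Δ‖ ^ 2)⁻¹ * (e j * Δ k), fun j k => ?_, ?_⟩
  · rw [Matrix.add_apply, add_sub_cancel_left, Matrix.of_apply, abs_mul, abs_mul]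
    have h1 : |e j| ≤ ‖e‖ := PiLp.norm_apply_le e j
    have h2 : |Δ k| ≤ ‖Δ‖ := PiLp.norm_apply_le Δ k
    rcases (norm_nonneg Δ).eq_or_lt with h | h
    · rw [← h]; simp; positivity
    · rw [abs_of_nonneg (by positivity : (0 : ℝ) ≤ (‖Δ‖ ^ 2)⁻¹), inv_mul_le_iff₀ (by positivity)]
      calc |e j| * |Δ k| ≤ (K * ‖Δ‖ ^ ζ * ‖Δ‖) * ‖Δ‖ := by
            gcongr
            exact h1.trans hbound
        _ = _ := by ring
  · rw [Matrix.add_mulVec, jacobian_mulVec]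
    have h3 : (Matrix.of fun j k => (‖Δ‖ ^ 2)⁻¹ * (e j * Δ k)) *ᵥ Δ.ofLp = e.ofLp := by
      ext j
      simp only [Matrix.mulVec, dotProduct, Matrix.of_apply]
      rcases (norm_nonneg Δ).eq_or_lt with h | h
      · have h0 : e = 0 := norm_le_zero_iff.1 (hbound.trans (by rw [← h, mul_zero]))
        simp [h0]
      · calc _ = (‖Δ‖ ^ 2)⁻¹ * (e j * ∑ k, Δ k ^ 2) := by
              rw [Finset.mul_sum, Finset.mul_sum]
              exact Finset.sum_congr rfl fun k _ => by ring
          _ = _ := by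
              rw [← EuclideanSpace.real_norm_sq_eq]
              field_simp
    rw [h3, he]
    simp

lemma fderiv_average {ι : Type*} [Fintype ι] {f : ι → Vec p → Vec r} {c : ℝ} {β : Vec p}
    (hf : ∀ i, DifferentiableAt ℝ (f i) β) :
    HasFDerivAt (fun b => c • ∑ i, f i b) (c • ∑ i, fderiv ℝ (f i) β) β :=
  (HasFDerivAt.fun_sum fun i _ => (hf i).hasFDerivAt).const_smul c

/-- The first order condition for an average of smooth moments, expanded around `b₀`. -/
lemma exists_expanded_foc {ι : Type*} [Fintype ι] {f : ι → Vec p → Vec r} {c : ℝ} (hc : 0 ≤ c)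
    {b₀ b : Vec p} {ρ ζ : ℝ} {d : ι → ℝ} (hb : b ∈ Metric.ball b₀ ρ) (hζ : 0 < ζ)
    (hf : ∀ i, ∀ β ∈ Metric.ball b₀ ρ, DifferentiableAt ℝ (f i) β ∧
      ‖fderiv ℝ (f i) β - fderiv ℝ (f i) b₀‖ ≤ d i * ‖β - b₀‖ ^ ζ)
    {W : Matrix (Fin r) (Fin r) ℝ} (hW : Wᵀ = W)
    (hmin : IsLocalMin (fun β => (c • ∑ i, f i β).ofLp ⬝ᵥ (W *ᵥ (c • ∑ i, f i β).ofLp)) b) :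
    ∃ G H : Matrix (Fin r) (Fin p) ℝ,
      (∀ j k, |G j k - c * ∑ i, jacobian (f i) b₀ j k| ≤ c * (∑ i, |d i|) * ‖b - b₀‖ ^ ζ) ∧
      (∀ j k, |H j k - c * ∑ i, jacobian (f i) b₀ j k| ≤ c * (∑ i, |d i|) * ‖b - b₀‖ ^ ζ) ∧
      Gᵀ *ᵥ (W *ᵥ ((c • ∑ i, f i b₀).ofLp + H *ᵥ (b - b₀).ofLp)) = 0 := by
  have hb₀ : b₀ ∈ Metric.ball b₀ ρ := Metric.mem_ball_self (Metric.pos_of_mem_ball hb)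
  have hD := fun β hβ => fderiv_average (c := c) fun i => (hf i β hβ).1
  set F : Vec p → Vec r := fun b => c • ∑ i, f i b
  have hF : ∀ β ∈ Metric.ball b₀ ρ, DifferentiableAt ℝ F β ∧
      ‖fderiv ℝ F β - fderiv ℝ F b₀‖ ≤ c * (∑ i, |d i|) * ‖β - b₀‖ ^ ζ := by
    intro β hβ
    refine ⟨(hD β hβ).differentiableAt, ?_⟩
    have hsub : c • ∑ i, fderiv ℝ (f i) β - c • ∑ i, fderiv ℝ (f i) b₀ =
        c • ∑ i, (fderiv ℝ (f i) β - fderiv ℝ (f i) b₀) := by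
      rw [Finset.sum_sub_distrib]; exact (smul_sub _ _ _).symm
    rw [(hD β hβ).fderiv, (hD b₀ hb₀).fderiv, hsub, norm_smul, Real.norm_of_nonneg hc, mul_assoc]
    gcongr
    rw [Finset.sum_mul]
    refine (norm_sum_le _ _).trans (Finset.sum_le_sum fun i _ => (hf i β hβ).2.trans ?_)
    gcongr
    exact le_abs_self _
  have hj : ∀ j k, jacobian F b₀ j k = c * ∑ i, jacobian (f i) b₀ j k := fun j k => by
    rw [jacobian_apply, (hD b₀ hb₀).fderiv]
    simp [jacobian_apply, Finset.sum_apply]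
  have hK : 0 ≤ c * ∑ i, |d i| := mul_nonneg hc (Finset.sum_nonneg fun i _ => abs_nonneg _)
  obtain ⟨H, hH, hexp⟩ := exists_mean_value_matrix hb hK hζ hF
  -- `G` is the Jacobian at the minimizer, from the first order condition; `H` is the mean value
  -- matrix.
  refine ⟨jacobian F b, H, fun j k => ?_, fun j k => ?_, ?_⟩
  · rw [← hj]
    exact (abs_jacobian_sub_le F b b₀ j k).trans (hF b hb).2
  · rw [← hj]; exact hH j k
  · change (jacobian F b)ᵀ *ᵥ (W *ᵥ ((F b₀).ofLp + H *ᵥ (b - b₀).ofLp)) = 0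
    rw [← hexp]
    exact jacobian_transpose_mulVec_eq_zero (hF b hb).1 hW hmin

end Deterministic

/-! ### Law of large numbers -/

section LawOfLargeNumbers

variable {Ω Z : Type*} [MeasurableSpace Ω] [MeasurableSpace Z] {P : Measure Ω}
  {F₀ : Measure Z} {z : ℕ → Ω → Z}

lemma identDistrib_comp (hlaw : ∀ i, HasLaw (z i) F₀ P) {E : Type*} [MeasurableSpace E] {f : Z → E}
    (hf : AEMeasurable f F₀) (i : ℕ) :
    IdentDistrib (fun ω => f (z i ω)) (fun ω => f (z 0 ω)) P P :=
  (IdentDistrib.mk (hlaw i).aemeasurable (hlaw 0).aemeasurable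
    ((hlaw i).map_eq.trans (hlaw 0).map_eq.symm)).comp_of_aemeasurable
      (by rwa [(hlaw i).map_eq])

lemma iIndepFun_comp (hlaw : ∀ i, HasLaw (z i) F₀ P) (hindep : iIndepFun z P) {E : Type*}
    [MeasurableSpace E] {f : Z → E} (hf : AEMeasurable f F₀) :
    iIndepFun (fun i ω => f (z i ω)) P :=
  hindep.comp₀ (fun _ => f) (fun i => (hlaw i).aemeasurable) fun i => by rwa [(hlaw i).map_eq]

/-- The weak law of large numbers. -/
lemma tendsto_average [IsProbabilityMeasure P] (hlaw : ∀ i, HasLaw (z i) F₀ P) (hindep : iIndepFun z P) {f : Z → ℝ}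
    (hf : Integrable f F₀) :
    Tendsto (fun q : ℕ × Ω => (q.1 : ℝ)⁻¹ * ∑ i : Fin q.1, f (z i q.2)) (probFilter P)
      (𝓝 (∫ x, f x ∂F₀)) := by
  have hfm := hf.aestronglyMeasurable.aemeasurable
  have hm : ∀ i, AEMeasurable (fun ω => f (z i ω)) P := fun i =>
    (identDistrib_comp hlaw hfm i).aemeasurable_fst
  have h0 : Integrable (fun ω => f (z 0 ω)) P := by
    have := (hlaw 0).map_eq ▸ hf
    exact this.comp_aemeasurable (hlaw 0).aemeasurable
  have hE : ∫ ω, f (z 0 ω) ∂P = ∫ x, f x ∂F₀ := (hlaw 0).integral_comp hf.1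
  have hSLLN := strong_law_ae (fun i ω => f (z i ω)) h0
    (fun i j hij => (iIndepFun_comp hlaw hindep hfm).indepFun hij)
    (identDistrib_comp hlaw hfm)
  rw [hE] at hSLLN
  have h := tendstoInMeasure_const_iff.1 (tendstoInMeasure_of_tendsto_ae (fun n =>
    ((Finset.aemeasurable_fun_sum (Finset.range n) fun i _ => hm i).const_smul
      (n : ℝ)⁻¹).aestronglyMeasurable) hSLLN)
  refine h.congr fun q => ?_
  simp [Finset.sum_range]

end LawOfLargeNumbers

/-! ### Consistency of the Jacobian and the linearized estimator -/

namespace CrossFit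

variable {Ω Z Γ Λ : Type*} {L p r : ℕ} (C : CrossFit Z Γ Λ L) (z : ℕ → Ω → Z)
  (S : MomentModel Z Γ Λ p r)

lemma psiHat_eq_average (n : ℕ) (β : Vec p) (ω : Ω) :
    C.psiHat z S n β ω = (n : ℝ)⁻¹ • ∑ i : Fin n,
      S.ψ (z i ω) β (C.gam z n (C.fold n i) ω) (C.lam z n (C.fold n i) ω) := by
  rw [psiHat, ← C.sum_sum_fold n]
  congr 1
  refine Finset.sum_congr rfl fun ℓ _ => Finset.sum_congr rfl fun i hi => ?_
  rw [(Finset.mem_filter.1 hi).2]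

variable [MeasurableSpace Ω] [MeasurableSpace Z] {P : Measure Ω} {F₀ : Measure Z} {C z S}
  [IsProbabilityMeasure F₀]

/-- A property that holds for almost every value of a new observation, with probability tending to
one given the training sample, holds at all observations of the group. -/
lemma eventually_forall_heldOut (hlaw : ∀ i, HasLaw (z i) F₀ P) (hindep : iIndepFun z P) {ℓ : Fin L}
    {U : ∀ n, Set (C.Train n ℓ × Z)} (hU : ∀ n, NullMeasurableSet (U n) (C.jointLaw F₀ n ℓ))
    (h : ∀ᶠ q in probFilter P, ∀ᵐ y ∂F₀, (C.train z q.1 ℓ q.2, y) ∈ U q.1) :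
    ∀ᶠ q in probFilter P, ∀ i : Fin q.1, C.fold q.1 i = ℓ →
      (C.train z q.1 ℓ q.2, z i q.2) ∈ U q.1 := by
  -- With the value `∞` off `U`, a single violation makes the group average infinite, while its
  -- conditional mean is zero. An average that is finite thus excludes every violation, however many
  -- observations the group has.
  have key := tendsto_avg hlaw hindep (ℓ := ℓ) (h := fun n => (U n)ᶜ.indicator fun _ => ∞)
    (fun n => aemeasurable_const.indicator₀ (hU n).compl) (tendsto_const_nhds.congr'
      (h.mono fun q hq => by
        change 0 = ∫⁻ y, _ ∂F₀
        rw [lintegral_congr_ae (g := fun _ => 0) (hq.mono fun y hy => by simp [hy])]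
        simp))
  filter_upwards [key.eventually (gt_mem_nhds ENNReal.zero_lt_top)] with q hq i hi
  by_contra hc
  refine hq.ne ?_
  rw [ENNReal.mul_eq_top]
  refine Or.inl ⟨by simp, ENNReal.sum_eq_top.2 ⟨i, by simp [hi], by simp [hc]⟩⟩

/-- The exceptional null set in `hs` depends on `(γ, λ)`, so it cannot be used directly at random
first steps. Independence of the held-out observations from the first steps makes up for this. -/
lemma eventually_smoothOn (hlaw : ∀ i, HasLaw (z i) F₀ P) (hindep : iIndepFun z P)
    {N : Set (Vec p)} {ζ δ : ℝ} {d : Z → ℝ} {nΓ : Γ → ℝ} {nΛ : Λ → ℝ} (hδ : 0 < δ)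
    (hΓ : ∀ ℓ, TendstoInMeasure P (fun (n : ℕ) ω => nΓ (C.gam z n ℓ ω)) atTop fun _ => 0)
    (hΛ : ∀ ℓ, TendstoInMeasure P (fun (n : ℕ) ω => nΛ (C.lam z n ℓ ω)) atTop fun _ => 0)
    (hs : ∀ γ lam, nΓ γ < δ → nΛ lam < δ → ∀ᵐ x ∂F₀, S.SmoothOn N ζ d x γ lam)
    (hU : ∀ n ℓ, NullMeasurableSet
        {q : C.Train n ℓ × Z | S.SmoothOn N ζ d q.2 (C.gammaHat n ℓ q.1) (C.lamHat n ℓ q.1)}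
        (C.jointLaw F₀ n ℓ)) :
    ∀ᶠ q in probFilter P, ∀ i : Fin q.1, S.SmoothOn N ζ d (z i q.2)
      (C.gam z q.1 (C.fold q.1 i) q.2) (C.lam z q.1 (C.fold q.1 i) q.2) := by
  have h : ∀ ℓ, ∀ᶠ q in probFilter P, ∀ i : Fin q.1, C.fold q.1 i = ℓ →
      S.SmoothOn N ζ d (z i q.2) (C.gam z q.1 ℓ q.2) (C.lam z q.1 ℓ q.2) := fun ℓ => by
    refine eventually_forall_heldOut hlaw hindep (fun n => hU n ℓ) ?_
    filter_upwards [(tendstoInMeasure_const_iff.1 (hΓ ℓ)).eventually (gt_mem_nhds hδ),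
      (tendstoInMeasure_const_iff.1 (hΛ ℓ)).eventually (gt_mem_nhds hδ)] with q h1 h2
    exact hs _ _ h1 h2
  filter_upwards [eventually_all.2 h] with q hq i
  exact hq _ i rfl

/-- The law of large numbers handles the Jacobian at the true first steps; the conditional Markov
inequality and mean consistency handle the difference in each group. -/
lemma tendsto_jacobian_average [IsProbabilityMeasure P] (hlaw : ∀ i, HasLaw (z i) F₀ P)
    (hindep : iIndepFun z P) (hmeas : C.JointlyMeasurable S F₀)
    (hint : ∀ j k, Integrable (fun x => S.jac₀ x S.γ₀ S.lam₀ j k) F₀)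
    (hconv : ∀ ℓ j k, TendstoZeroInProb P fun (n : ℕ) ω =>
      ∫⁻ x, ‖S.jac₀ x (C.gam z n ℓ ω) (C.lam z n ℓ ω) j k - S.jac₀ x S.γ₀ S.lam₀ j k‖ₑ ∂F₀)
    (j : Fin r) (k : Fin p) :
    Tendsto (fun q : ℕ × Ω => (q.1 : ℝ)⁻¹ * ∑ i : Fin q.1, S.jac₀ (z i q.2)
      (C.gam z q.1 (C.fold q.1 i) q.2) (C.lam z q.1 (C.fold q.1 i) q.2) j k)
      (probFilter P) (𝓝 (S.M F₀ j k)) := by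
  have hdiff : ∀ ℓ, Tendsto (fun q : ℕ × Ω => (q.1 : ℝ)⁻¹ *
      ∑ i : Fin q.1 with C.fold q.1 i = ℓ, (S.jac₀ (z i q.2) (C.gam z q.1 ℓ q.2)
        (C.lam z q.1 ℓ q.2) j k - S.jac₀ (z i q.2) S.γ₀ S.lam₀ j k)) (probFilter P) (𝓝 0) := by
    intro ℓ
    have hm : ∀ n, AEMeasurable (fun q : C.Train n ℓ × Z =>
        S.jac₀ q.2 (C.gammaHat n ℓ q.1) (C.lamHat n ℓ q.1) j k - S.jac₀ q.2 S.γ₀ S.lam₀ j k)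
        (C.jointLaw F₀ n ℓ) := fun n =>
      (hmeas.jac_hat n ℓ j k).sub (AEMeasurable.comp_snd (f := fun x => S.jac₀ x S.γ₀ S.lam₀ j k)
        (hint j k).aestronglyMeasurable.aemeasurable)
    have hlim := tendstoZeroInProb_iff.1 (hconv ℓ j k)
    simp only [gam_eq, lam_eq] at hlim
    have key := tendsto_avg hlaw hindep (fun n => (hm n).enorm) hlim
    rw [tendsto_zero_iff_enorm_tendsto_zero]
    refine tendsto_of_tendsto_of_tendsto_of_le_of_le tendsto_const_nhds key (fun _ => zero_le)
      fun q => ?_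
    rcases Nat.eq_zero_or_pos q.1 with h0 | h0
    · simp [h0]
    · have hinv : ‖(q.1 : ℝ)⁻¹‖ₑ = (q.1 : ℝ≥0∞)⁻¹ := by
        rw [enorm_inv (by positivity)]
        simp
      rw [enorm_mul, hinv]
      gcongr
      exact enorm_sum_le _ _
  have key := (tendsto_average hlaw hindep (hint j k)).add
    (tendsto_finsetSum (Finset.univ : Finset (Fin L)) fun ℓ _ => hdiff ℓ)
  simp only [Finset.sum_const_zero, add_zero] at key
  refine key.congr fun q => ?_
  rw [← Finset.mul_sum, ← mul_add]
  congr 1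
  simp only [Finset.sum_sub_distrib]
  rw [C.sum_sum_fold q.1 fun i => S.jac₀ (z i q.2) S.γ₀ S.lam₀ j k, add_sub_cancel,
    ← C.sum_sum_fold q.1 fun i => S.jac₀ (z i q.2) (C.gam z q.1 (C.fold q.1 i) q.2)
      (C.lam z q.1 (C.fold q.1 i) q.2) j k]
  refine Finset.sum_congr rfl fun ℓ _ => Finset.sum_congr rfl fun i hi => ?_
  rw [(Finset.mem_filter.1 hi).2]

/-- The first order condition of the estimator, expanded around the true value. -/
theorem exists_tendsto_expanded_foc [AddCommGroup Γ] [Module ℝ Γ] [AddCommGroup Λ] [Module ℝ Λ]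
    [IsProbabilityMeasure P] (hlaw : ∀ i, HasLaw (z i) F₀ P)
    (hindep : iIndepFun z P) (hmeas : C.JointlyMeasurable S F₀)
    (hjac : C.JacobianRegular z S F₀ P)
    {What : ℕ → Ω → Matrix (Fin r) (Fin r) ℝ} (hWpsd : ∀ n, ∀ᵐ ω ∂P, (What n ω).PosSemidef)
    {B : Set (Vec p)} (hB : S.β₀ ∈ interior B) {βhat : ℕ → Ω → Vec p}
    (hβmin : ∀ n, ∀ᵐ ω ∂P,
      βhat n ω ∈ B ∧ IsMinOn (C.criterion z S (What n ω) n ω) B (βhat n ω))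
    (hβ : TendstoInMeasure P βhat atTop fun _ => S.β₀) :
    ∃ G H : ℕ × Ω → Matrix (Fin r) (Fin p) ℝ,
      Tendsto G (probFilter P) (𝓝 (S.M F₀)) ∧ Tendsto H (probFilter P) (𝓝 (S.M F₀)) ∧
      ∀ᶠ q in probFilter P, (G q)ᵀ *ᵥ (What q.1 q.2 *ᵥ ((C.psiHat z S q.1 S.β₀ q.2).ofLp +
        H q *ᵥ (βhat q.1 q.2 - S.β₀).ofLp)) = 0 := by
  obtain ⟨hint, ⟨N, hN, nΓ, nΛ, hΓ, hΛ, δ, ζ, d, hδ, hζ, hd, hs, hU⟩, hconv⟩ := hjac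
  have hsmooth := eventually_smoothOn hlaw hindep (nΓ := fun γ => nΓ (γ - S.γ₀))
    (nΛ := fun l => nΛ (l - S.lam₀)) hδ hΓ hΛ hs hU
  -- The ball lies in `N`, for smoothness, and in `B`, so that a minimizer over `B` inside it is a
  -- local minimizer.
  obtain ⟨ρ, hρ, hball⟩ := Metric.mem_nhds_iff.1 (inter_mem hN (mem_interior_iff_mem_nhds.1 hB))
  have hβ' := tendstoInMeasure_const_iff.1 hβ
  set J : ℕ × Ω → Matrix (Fin r) (Fin p) ℝ := fun q => Matrix.of fun j k =>
    (q.1 : ℝ)⁻¹ * ∑ i : Fin q.1, S.jac₀ (z i q.2)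
      (C.gam z q.1 (C.fold q.1 i) q.2) (C.lam z q.1 (C.fold q.1 i) q.2) j k
  -- The Hölder bound for the averaged derivative: the average of `|d|` converges, and the power of
  -- the estimation error tends to zero.
  set R : ℕ × Ω → ℝ := fun q =>
    (q.1 : ℝ)⁻¹ * (∑ i : Fin q.1, |d (z i q.2)|) * ‖βhat q.1 q.2 - S.β₀‖ ^ ζ
  have hR : Tendsto R (probFilter P) (𝓝 0) := by
    have h1 := (tendsto_iff_norm_sub_tendsto_zero.1 hβ').rpow_const (p := ζ) (Or.inr hζ.le)
    rw [Real.zero_rpow hζ.ne'] at h1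
    simpa using (tendsto_average hlaw hindep hd.abs).mul h1
  have hfoc : ∀ᶠ q in probFilter P, ∃ GH : Matrix (Fin r) (Fin p) ℝ × Matrix (Fin r) (Fin p) ℝ,
      (∀ j k, |GH.1 j k - J q j k| ≤ R q) ∧ (∀ j k, |GH.2 j k - J q j k| ≤ R q) ∧
      GH.1ᵀ *ᵥ (What q.1 q.2 *ᵥ ((C.psiHat z S q.1 S.β₀ q.2).ofLp +
        GH.2 *ᵥ (βhat q.1 q.2 - S.β₀).ofLp)) = 0 := by
    filter_upwards [hsmooth, hβ'.eventually (Metric.ball_mem_nhds _ hρ),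
      eventually_probFilter_of_ae hWpsd (p := fun q => (What q.1 q.2).PosSemidef),
      eventually_probFilter_of_ae hβmin (p := fun q => βhat q.1 q.2 ∈ B ∧
        IsMinOn (C.criterion z S (What q.1 q.2) q.1 q.2) B (βhat q.1 q.2))] with q hq hqβ hqW hqm
    have hW : (What q.1 q.2)ᵀ = What q.1 q.2 := by
      rw [← Matrix.conjTranspose_eq_transpose_of_trivial]; exact hqW.isHermitian
    have hmin := hqm.2.isLocalMin (mem_of_superset (Metric.isOpen_ball.mem_nhds hqβ)
      fun β hβ => (hball hβ).2)
    have hcrit : C.criterion z S (What q.1 q.2) q.1 q.2 = fun β =>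
        ((q.1 : ℝ)⁻¹ • ∑ i : Fin q.1, S.ψ (z i q.2) β (C.gam z q.1 (C.fold q.1 i) q.2)
          (C.lam z q.1 (C.fold q.1 i) q.2)).ofLp ⬝ᵥ (What q.1 q.2 *ᵥ
        ((q.1 : ℝ)⁻¹ • ∑ i : Fin q.1, S.ψ (z i q.2) β (C.gam z q.1 (C.fold q.1 i) q.2)
          (C.lam z q.1 (C.fold q.1 i) q.2)).ofLp) := by
      ext β
      rw [criterion, psiHat_eq_average]
    rw [hcrit] at hmin
    obtain ⟨G, H, hG, hH, h0⟩ := exists_expanded_foc (c := (q.1 : ℝ)⁻¹) (by positivity) hqβ hζ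
      (fun i β hβ => hq i β (hball hβ).1) hW hmin
    exact ⟨⟨G, H⟩, hG, hH, by rw [psiHat_eq_average]; exact h0⟩
  obtain ⟨GH, hGH⟩ := Filter.skolem.1 hfoc
  have hlim : ∀ A : ℕ × Ω → Matrix (Fin r) (Fin p) ℝ,
      (∀ᶠ q in probFilter P, ∀ j k, |A q j k - J q j k| ≤ R q) →
      Tendsto A (probFilter P) (𝓝 (S.M F₀)) := by
    intro A hA
    refine tendsto_pi_nhds.2 fun j => tendsto_pi_nhds.2 fun k => ?_
    have h1 : Tendsto (fun q => A q j k - J q j k) (probFilter P) (𝓝 0) :=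
      squeeze_zero_norm' (hA.mono fun q hq => hq j k) hR
    have h2 := h1.add (tendsto_jacobian_average hlaw hindep hmeas hint hconv j k)
    rw [zero_add] at h2
    exact h2.congr fun q => sub_add_cancel _ _
  exact ⟨fun q => (GH q).1, fun q => (GH q).2, hlim _ (hGH.mono fun q hq => hq.1),
    hlim _ (hGH.mono fun q hq => hq.2.1), hGH.mono fun q hq => hq.2.2⟩

end CrossFit

/-! ### Central limit theorem and boundedness in probability -/

section CentralLimit

variable {Ω Z : Type*} [MeasurableSpace Ω] [MeasurableSpace Z] {P : Measure Ω}
  {F₀ : Measure Z} {z : ℕ → Ω → Z}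

lemma aemeasurable_normalized_sum {p : ℕ} (hlaw : ∀ i, HasLaw (z i) F₀ P) {X : Z → Vec p}
    (hX : AEMeasurable X F₀) (n : ℕ) :
    AEMeasurable (fun ω => (√(n : ℝ))⁻¹ • ∑ i : Fin n, X (z i ω)) P := by
  have h : AEMeasurable (fun ω => ∑ i : Fin n, X (z i ω)) P :=
    Finset.aemeasurable_fun_sum _ fun i _ => (identDistrib_comp hlaw hX i.1).aemeasurable_fst
  exact h.const_smul (√(n : ℝ))⁻¹

/-- The multivariate central limit theorem, for a limit covariance matrix `V`. -/
theorem tendstoInDistribution_multivariate [IsProbabilityMeasure P] {p : ℕ} (hlaw : ∀ i, HasLaw (z i) F₀ P)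
    (hindep : iIndepFun z P) {X : Z → Vec p} (hX : MemLp X 2 F₀) [IsProbabilityMeasure F₀]
    (hX0 : ∫ x, X x ∂F₀ = 0) {V : Matrix (Fin p) (Fin p) ℝ} (hV : V.PosSemidef)
    (hcov : ∀ t : Vec p, ∫ x, (inner ℝ (X x) t) ^ 2 ∂F₀ = t.ofLp ⬝ᵥ (V *ᵥ t.ofLp)) :
    TendstoInDistribution (fun (n : ℕ) ω => (√(n : ℝ))⁻¹ • ∑ i : Fin n, X (z i ω)) atTop id
      (fun _ => P) (multivariateGaussian 0 V) where
  forall_aemeasurable := aemeasurable_normalized_sum hlaw hX.1.aemeasurable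
  aemeasurable_limit := aemeasurable_id
  tendsto := by
    refine ProbabilityMeasure.tendsto_iff_tendsto_charFun.2 fun t => ?_
    set f : Z → ℝ := fun x => inner ℝ (X x) t
    have hf : MemLp f 2 F₀ := hX.inner_const t
    have hfm := hf.1.aemeasurable
    have hfP : MemLp (fun ω => f (z 0 ω)) 2 P :=
      MemLp.comp_of_map (g := f) (by rwa [(hlaw 0).map_eq]) (hlaw 0).aemeasurable
    have hE : ∫ ω, f (z 0 ω) ∂P = 0 := by
      rw [show ∫ ω, f (z 0 ω) ∂P = ∫ x, f x ∂F₀ from (hlaw 0).integral_comp hf.1]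
      have h := integral_inner (𝕜 := ℝ) (hX.integrable one_le_two) t
      simp only [f, real_inner_comm t]
      rw [h, hX0, inner_zero_right]
    have hvar : Var[fun ω => f (z 0 ω); P] = t.ofLp ⬝ᵥ (V *ᵥ t.ofLp) := by
      rw [variance_of_integral_eq_zero hfP.1.aemeasurable hE, ← hcov t]
      exact (hlaw 0).integral_comp (f := fun x => f x ^ 2) (hf.1.pow 2)
    have hclt := tendstoInDistribution_inv_sqrt_mul_sum_sub (X := fun i ω => f (z i ω))
      (Y := id) (P' := gaussianReal 0 Var[fun ω => f (z 0 ω); P].toNNReal) HasLaw.id hfP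
      (iIndepFun_comp hlaw hindep hfm) (identDistrib_comp hlaw hfm)
    -- Cramér–Wold: the characteristic function of the vector at `t` is that of its projection on
    -- `t` at `1`, so the scalar theorem suffices.
    have h1 := ProbabilityMeasure.tendsto_iff_tendsto_charFun.1 hclt.tendsto 1
    simp only [ProbabilityMeasure.coe_mk, Measure.map_id] at h1 ⊢
    rw [charFun_gaussianReal, hvar] at h1
    rw [charFun_multivariateGaussian hV]
    have hnn : 0 ≤ t.ofLp ⬝ᵥ (V *ᵥ t.ofLp) := by simpa using hV.dotProduct_mulVec_nonneg t.ofLp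
    convert h1 using 2 with n
    · rw [charFun_apply, charFun_apply, integral_map, integral_map]
      · congr 1
        ext ω
        rw [hE, mul_zero, sub_zero, Finset.sum_range, inner_smul_left, sum_inner]
        simp [f]
      · exact hclt.forall_aemeasurable n
      · exact (by fun_prop : Continuous fun x : ℝ =>
          Complex.exp (inner ℝ x 1 * Complex.I)).aestronglyMeasurable
      · exact aemeasurable_normalized_sum hlaw hX.1.aemeasurable n
      · exact (by fun_prop : Continuous fun x : Vec p =>
          Complex.exp (inner ℝ x t * Complex.I)).aestronglyMeasurable
    · simp [Real.coe_toNNReal _ hnn]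

/-- Normalized sums of centered square integrable variables are bounded in probability. -/
lemma bddInProb_normalized_sum [IsProbabilityMeasure F₀] (hlaw : ∀ i, HasLaw (z i) F₀ P)
    (hindep : iIndepFun z P) {f : Z → ℝ} (hf : MemLp f 2 F₀) (hf0 : ∫ x, f x ∂F₀ = 0) :
    BddInProb P fun n ω => (√(n : ℝ))⁻¹ * ∑ i : Fin n, f (z i ω) := by
  intro ε hε
  have hfin : ∫⁻ x, ‖f x‖ₑ ^ 2 ∂F₀ ≠ ∞ := by
    have h := hf.2
    rw [eLpNorm_lt_top_iff_lintegral_rpow_enorm_lt_top (by simp) (by simp)] at h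
    simpa using h.ne
  have hlim : Tendsto (fun K : ℕ => (∫⁻ x, ‖f x‖ₑ ^ 2 ∂F₀) / (K : ℝ≥0∞) ^ 2) atTop (𝓝 0) := by
    have h := ENNReal.Tendsto.const_div (ENNReal.Tendsto.pow (n := 2) ENNReal.tendsto_nat_nhds_top)
      (a := ∫⁻ x, ‖f x‖ₑ ^ 2 ∂F₀) (Or.inr hfin)
    simpa using h
  obtain ⟨K, hK, hK0⟩ := ((ENNReal.tendsto_nhds_zero.1 hlim ε hε).and (eventually_gt_atTop 0)).exists
  refine ⟨K, fun n => ?_⟩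
  have h1 : HasLaw (fun ω (i : Fin n) => z i ω) (Measure.pi fun _ => F₀) P :=
    (hindep.precomp Fin.val_injective).hasLaw_pi fun i => hlaw i
  have h2 := pi_measure_sum_sub_ge_le (κ := Fin n) hf (n := n) (Fintype.card_fin n).le
    (η := K) (by exact_mod_cast hK0) (by simp)
  refine le_trans ?_ (h2.trans hK)
  rw [← h1.map_eq]
  refine le_trans (measure_mono fun ω hω => ?_) (Measure.le_map_apply h1.aemeasurable _)
  simp only [hf0, sub_zero, Set.mem_preimage, Set.mem_ofPred_eq] at hω ⊢
  rw [← ofReal_norm, ← ENNReal.ofReal_natCast]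
  exact ENNReal.ofReal_le_ofReal hω.le

/-- Gives uniqueness of limits in probability, by which `W` inherits symmetry from `Ŵ`. -/
lemma neBot_probFilter [IsProbabilityMeasure P] : (probFilter P).NeBot := by
  rw [neBot_iff]
  intro h
  have h' : ∀ᶠ q in probFilter P, False := by rw [h]; trivial
  rw [eventually_probFilter] at h'
  simp at h'

end CentralLimit

/-! ### Limits of matrix expressions and the solved first order condition -/

section Matrices

variable {α : Type*} {l : Filter α} {m n k : ℕ}

lemma Filter.Tendsto.matrix_mul_of_tendsto {A : α → Matrix (Fin m) (Fin n) ℝ} {B : α → Matrix (Fin n) (Fin k) ℝ}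
    {A₀ : Matrix (Fin m) (Fin n) ℝ} {B₀ : Matrix (Fin n) (Fin k) ℝ} (hA : Tendsto A l (𝓝 A₀))
    (hB : Tendsto B l (𝓝 B₀)) : Tendsto (fun q => A q * B q) l (𝓝 (A₀ * B₀)) :=
  ((continuous_fst.matrix_mul continuous_snd).tendsto (A₀, B₀)).comp (hA.prodMk_nhds hB)

lemma Filter.Tendsto.matrix_transpose_of_tendsto {A : α → Matrix (Fin m) (Fin n) ℝ}
    {A₀ : Matrix (Fin m) (Fin n) ℝ} (hA : Tendsto A l (𝓝 A₀)) :
    Tendsto (fun q => (A q)ᵀ) l (𝓝 A₀ᵀ) :=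
  (continuous_id.matrix_transpose.tendsto A₀).comp hA

lemma Filter.Tendsto.matrix_inv_of_tendsto {A : α → Matrix (Fin n) (Fin n) ℝ}
    {A₀ : Matrix (Fin n) (Fin n) ℝ} (hA : Tendsto A l (𝓝 A₀)) (h : A₀.det ≠ 0) :
    Tendsto (fun q => (A q)⁻¹) l (𝓝 A₀⁻¹) := by
  simp only [Matrix.inv_def, Ring.inverse_eq_inv']
  exact (((continuous_id.matrix_det.tendsto A₀).comp hA).inv₀ h).smul
    ((continuous_id.matrix_adjugate.tendsto A₀).comp hA)

/-- Solving an expanded first order condition. -/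
lemma eq_neg_mulVec_of_foc {G H : Matrix (Fin m) (Fin n) ℝ} {W : Matrix (Fin m) (Fin m) ℝ}
    {f : Fin m → ℝ} {Δ : Fin n → ℝ} (h : Gᵀ *ᵥ (W *ᵥ (f + H *ᵥ Δ)) = 0)
    (hdet : (Gᵀ * W * H).det ≠ 0) : Δ = -(((Gᵀ * W * H)⁻¹ * (Gᵀ * W)) *ᵥ f) := by
  have h1 : (Gᵀ * W * H) *ᵥ Δ = -((Gᵀ * W) *ᵥ f) := by
    rw [Matrix.mulVec_add, Matrix.mulVec_add] at h
    simp only [Matrix.mulVec_mulVec, ← Matrix.mul_assoc] at h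
    exact eq_neg_of_add_eq_zero_right h
  calc Δ = ((Gᵀ * W * H)⁻¹ * (Gᵀ * W * H)) *ᵥ Δ := by
        rw [Matrix.nonsing_inv_mul _ (isUnit_iff_ne_zero.2 hdet), Matrix.one_mulVec]
    _ = _ := by rw [← Matrix.mulVec_mulVec, h1, Matrix.mulVec_neg, Matrix.mulVec_mulVec]

end Matrices

/-! ### The limit covariance matrix -/

namespace MomentModel

variable {Z Γ Λ : Type*} {p r : ℕ} {S : MomentModel Z Γ Λ p r} [MeasurableSpace Z]
  {F₀ : Measure Z}

lemma memLp_psi_apply (hsq : MemLp S.ψ₀ 2 F₀) (j : Fin r) : MemLp (fun x => S.ψ₀ x j) 2 F₀ :=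
  (EuclideanSpace.proj (𝕜 := ℝ) j).comp_memLp' hsq

lemma integral_dotProduct_sq (hsq : MemLp S.ψ₀ 2 F₀) (u : Fin r → ℝ) :
    ∫ x, ((S.ψ₀ x).ofLp ⬝ᵥ u) ^ 2 ∂F₀ = u ⬝ᵥ (S.Omega F₀ *ᵥ u) := by
  have hjk : ∀ j k, Integrable (fun x => u j * (S.ψ₀ x j * S.ψ₀ x k * u k)) F₀ := fun j k =>
    ((((memLp_psi_apply hsq j).integrable_mul (memLp_psi_apply hsq k))).mul_const _).const_mul _
  have h : ∀ x, ((S.ψ₀ x).ofLp ⬝ᵥ u) ^ 2 = ∑ j, ∑ k, u j * (S.ψ₀ x j * S.ψ₀ x k * u k) := by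
    intro x
    rw [sq, dotProduct, Finset.sum_mul_sum]
    exact Finset.sum_congr rfl fun j _ => Finset.sum_congr rfl fun k _ => by ring
  simp_rw [h]
  rw [integral_finsetSum _ fun j _ => integrable_finsetSum _ fun k _ => hjk j k]
  simp only [dotProduct, Matrix.mulVec, Finset.mul_sum]
  refine Finset.sum_congr rfl fun j _ => ?_
  rw [integral_finsetSum _ fun k _ => hjk j k]
  refine Finset.sum_congr rfl fun k _ => ?_
  rw [integral_const_mul, integral_mul_const]
  rfl

lemma posSemidef_Omega (hsq : MemLp S.ψ₀ 2 F₀) : (S.Omega F₀).PosSemidef := by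
  refine .of_dotProduct_mulVec_nonneg ?_ fun u => ?_
  · ext j k
    simp [Omega, mul_comm]
  · rw [star_trivial, ← integral_dotProduct_sq hsq]
    exact integral_nonneg fun x => sq_nonneg _

lemma integral_psi₀ (hzero : S.MeanZero F₀) : ∫ x, S.ψ₀ x ∂F₀ = 0 := by
  simp only [ψ₀, ψ]
  rw [integral_add hzero.integrable_m hzero.integrable_phi, hzero.integral_m, hzero.integral_phi,
    add_zero]

/-- The sandwich form `A Ω Aᵀ` shows that `V` is positive semidefinite and is the covariance matrix
of `A ψ₀`. -/
lemma V_eq {W : Matrix (Fin r) (Fin r) ℝ} (hW : Wᵀ = W) :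
    S.V F₀ W = ((S.M F₀)ᵀ * W * S.M F₀)⁻¹ * ((S.M F₀)ᵀ * W) * S.Omega F₀ *
      (((S.M F₀)ᵀ * W * S.M F₀)⁻¹ * ((S.M F₀)ᵀ * W))ᵀ := by
  have hQ : ((S.M F₀)ᵀ * W * S.M F₀)ᵀ = (S.M F₀)ᵀ * W * S.M F₀ := by
    simp [Matrix.transpose_mul, hW, Matrix.mul_assoc]
  rw [Matrix.transpose_mul, Matrix.transpose_nonsing_inv, hQ, Matrix.transpose_mul, hW,
    Matrix.transpose_transpose, V]
  simp only [Matrix.mul_assoc]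

end MomentModel

lemma inner_toEuclideanLin {p r : ℕ} (A : Matrix (Fin p) (Fin r) ℝ) (v : Vec r) (t : Vec p) :
    inner ℝ (Matrix.toEuclideanLin A v) t = v.ofLp ⬝ᵥ (Aᵀ *ᵥ t.ofLp) := by
  rw [EuclideanSpace.inner_eq_star_dotProduct, star_trivial, Matrix.dotProduct_mulVec,
    Matrix.vecMul_transpose, dotProduct_comm]
  rfl

namespace MomentModel

variable {Ω Z Γ Λ : Type*} {p r : ℕ} {S : MomentModel Z Γ Λ p r} [MeasurableSpace Ω]
  [MeasurableSpace Z] {P : Measure Ω} [IsProbabilityMeasure P] {F₀ : Measure Z}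
  [IsProbabilityMeasure F₀] {z : ℕ → Ω → Z}

/-- The central limit theorem for linear images of the moments at the true values. -/
lemma tendstoInDistribution_linear_psi₀ (hlaw : ∀ i, HasLaw (z i) F₀ P) (hindep : iIndepFun z P)
    (hzero : S.MeanZero F₀) (hsq : MemLp S.ψ₀ 2 F₀) (A : Matrix (Fin p) (Fin r) ℝ) :
    TendstoInDistribution (fun (n : ℕ) ω => (√(n : ℝ))⁻¹ • ∑ i : Fin n,
      Matrix.toEuclideanLin A (S.ψ₀ (z i ω))) atTop id
      (fun _ => P) (multivariateGaussian 0 (A * S.Omega F₀ * Aᵀ)) := by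
  refine tendstoInDistribution_multivariate hlaw hindep
    (X := fun x => (Matrix.toEuclideanLin A).toContinuousLinearMap (S.ψ₀ x))
    ((Matrix.toEuclideanLin A).toContinuousLinearMap.comp_memLp' hsq) ?_ ?_ fun t => ?_
  · rw [ContinuousLinearMap.integral_comp_comm _ (hsq.integrable one_le_two), integral_psi₀ hzero,
      map_zero]
  · simpa using (posSemidef_Omega hsq).mul_mul_conjTranspose_same A
  · simp only [LinearMap.coe_toContinuousLinearMap', inner_toEuclideanLin]
    rw [integral_dotProduct_sq hsq, ← Matrix.mulVec_mulVec, ← Matrix.mulVec_mulVec,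
      Matrix.dotProduct_mulVec t.ofLp, ← Matrix.mulVec_transpose]

end MomentModel

/-! ### Asymptotic normality -/

theorem theorem16 {Ω Z Γ Λ : Type*} [MeasurableSpace Ω] [MeasurableSpace Z]
    [AddCommGroup Γ] [Module ℝ Γ] [AddCommGroup Λ] [Module ℝ Λ] {p r L : ℕ}
    (P : Measure Ω) [IsProbabilityMeasure P] (F₀ : Measure Z) [IsProbabilityMeasure F₀]
    -- i.i.d. observations with distribution `F₀`
    (z : ℕ → Ω → Z) (hlaw : ∀ i, HasLaw (z i) F₀ P) (hindep : iIndepFun z P)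
    -- moment functions and cross-fit first steps
    (S : MomentModel Z Γ Λ p r) (hzero : S.MeanZero F₀)
    (C : CrossFit Z Γ Λ L) (hmeas : C.JointlyMeasurable S F₀)
    (hms : C.MeanSquareConsistent z S F₀ P)
    (hrem : C.SecondOrderRemainder z S F₀ P)
    (hrate : C.RateConditions z S F₀ P)
    (hjac : C.JacobianRegular z S F₀ P)
    -- the weighting matrix
    (What : ℕ → Ω → Matrix (Fin r) (Fin r) ℝ) (W : Matrix (Fin r) (Fin r) ℝ)
    (hWpsd : ∀ n, ∀ᵐ ω ∂P, (What n ω).PosSemidef)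
    (hW : ∀ j k, TendstoInMeasure P (fun n ω => What n ω j k) atTop fun _ => W j k)
    -- the GMM estimator over the parameter space `B`
    (B : Set (Vec p)) (hB : S.β₀ ∈ interior B)
    (βhat : ℕ → Ω → Vec p) (hβmeas : ∀ n, AEMeasurable (βhat n) P)
    (hβmin : ∀ n, ∀ᵐ ω ∂P,
      βhat n ω ∈ B ∧ IsMinOn (C.criterion z S (What n ω) n ω) B (βhat n ω))
    (hβ : TendstoInMeasure P βhat atTop fun _ => S.β₀)
    -- nonsingularity and second moments
    (hns : IsUnit ((S.M F₀)ᵀ * W * S.M F₀))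
    (hsq : MemLp S.ψ₀ 2 F₀) :
    (S.V F₀ W).PosSemidef ∧
    TendstoInDistribution (fun (n : ℕ) ω => √(n : ℝ) • (βhat n ω - S.β₀)) atTop id
      (fun _ => P) (multivariateGaussian 0 (S.V F₀ W)) := by
  have hne := neBot_probFilter (P := P)
  have hWjk := fun j k => tendstoInMeasure_const_iff.1 (hW j k)
  have hWlim : Tendsto (fun q : ℕ × Ω => What q.1 q.2) (probFilter P) (𝓝 W) :=
    tendsto_pi_nhds.2 fun j => tendsto_pi_nhds.2 fun k => hWjk j k
  have hWt : Wᵀ = W := by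
    refine tendsto_nhds_unique_of_eventuallyEq hWlim.matrix_transpose_of_tendsto hWlim ?_
    filter_upwards [eventually_probFilter_of_ae hWpsd
      (p := fun q => (What q.1 q.2).PosSemidef)] with q hq
    rw [← Matrix.conjTranspose_eq_transpose_of_trivial]
    exact hq.isHermitian
  set A := ((S.M F₀)ᵀ * W * S.M F₀)⁻¹ * ((S.M F₀)ᵀ * W) with hA
  have hV : S.V F₀ W = A * S.Omega F₀ * Aᵀ := MomentModel.V_eq hWt
  have hdet : ((S.M F₀)ᵀ * W * S.M F₀).det ≠ 0 :=
    ((Matrix.isUnit_iff_isUnit_det _).1 hns).ne_zero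
  refine ⟨?_, ?_⟩
  · rw [hV]
    simpa using (MomentModel.posSemidef_Omega hsq).mul_mul_conjTranspose_same A
  -- The influence function is `-A ψ₀`; the sign cancels in the covariance.
  have hclt := MomentModel.tendstoInDistribution_linear_psi₀ hlaw hindep hzero hsq (-A)
  rw [Matrix.transpose_neg, Matrix.neg_mul, Matrix.neg_mul, Matrix.mul_neg, neg_neg, ← hV] at hclt
  refine tendstoInDistribution_of_tendstoInMeasure_sub _ _ hclt ?_
    fun n => ((hβmeas n).sub_const S.β₀).const_smul √(n : ℝ)
  refine tendstoInMeasure_const_iff.2 ?_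
  obtain ⟨G, H, hG, hH, hfoc⟩ :=
    CrossFit.exists_tendsto_expanded_foc hlaw hindep hmeas hjac hWpsd hB hβmin hβ
  have hGW := hG.matrix_transpose_of_tendsto.matrix_mul_of_tendsto hWlim
  have hQ := hGW.matrix_mul_of_tendsto hH
  have hK := (hQ.matrix_inv_of_tendsto hdet).matrix_mul_of_tendsto hGW
  rw [← hA] at hK
  set K : ℕ × Ω → Matrix (Fin p) (Fin r) ℝ := fun q =>
    ((G q)ᵀ * What q.1 q.2 * H q)⁻¹ * ((G q)ᵀ * What q.1 q.2)
  have hKjk : ∀ k j, Tendsto (fun q => K q k j) (probFilter P) (𝓝 (A k j)) := fun k j =>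
    tendsto_pi_nhds.1 (tendsto_pi_nhds.1 hK k) j
  have hψ := CrossFit.tendsto_psiHat_sub hlaw hindep hmeas hzero hms hrem hrate
  set D : ℕ × Ω → Vec r := fun q => √(q.1 : ℝ) • C.psiHat z S q.1 S.β₀ q.2 -
    (√(q.1 : ℝ))⁻¹ • ∑ i : Fin q.1, S.ψ₀ (z i q.2) with hD
  have hdetQ : ∀ᶠ q in probFilter P, ((G q)ᵀ * What q.1 q.2 * H q).det ≠ 0 :=
    ((continuous_id.matrix_det.tendsto _).comp hQ).eventually_ne hdet
  rw [tendsto_vec_iff]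
  intro k
  have h1 : Tendsto (fun q => ∑ j, K q k j * D q j) (probFilter P) (𝓝 0) := by
    rw [← Finset.sum_const_zero (s := (Finset.univ : Finset (Fin r)))]
    refine tendsto_finsetSum _ fun j _ => ?_
    have h := (hKjk k j).mul (tendsto_vec_iff.1 hψ j)
    rwa [PiLp.zero_apply, mul_zero] at h
  -- The normalized sums are bounded in probability but do not converge along the filter, so this
  -- product needs more than continuity of multiplication.
  have h2 : Tendsto (fun q : ℕ × Ω => ∑ j, (K q k j - A k j) *
      ((√(q.1 : ℝ))⁻¹ * ∑ i : Fin q.1, S.ψ₀ (z i q.2) j)) (probFilter P) (𝓝 0) := by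
    rw [← Finset.sum_const_zero (s := (Finset.univ : Finset (Fin r)))]
    refine tendsto_finsetSum _ fun j _ => ?_
    refine tendsto_mul_of_bddInProb (bddInProb_normalized_sum hlaw hindep
      (MomentModel.memLp_psi_apply hsq j) ?_) (tendsto_sub_nhds_zero_iff.2 (hKjk k j))
    rw [← integral_vec_apply (hsq.integrable one_le_two), MomentModel.integral_psi₀ hzero,
      PiLp.zero_apply]
  have h3 := (h1.add h2).neg
  rw [add_zero, neg_zero] at h3
  -- With `s` the normalized sum of the `ψ₀(z_i)`, `-K √n ψ̂(β₀) + A s = -(K D + (K - A) s)`, valid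
  -- wherever the first order condition holds and can be solved.
  refine h3.congr' ?_
  filter_upwards [hfoc, hdetQ] with q hq hqd
  have hΔ := congrFun (eq_neg_mulVec_of_foc hq hqd) k
  change (βhat q.1 q.2 - S.β₀) k = -∑ j, K q k j * (C.psiHat z S q.1 S.β₀ q.2) j at hΔ
  have hX : ((√(q.1 : ℝ))⁻¹ • ∑ i : Fin q.1, Matrix.toEuclideanLin (-A) (S.ψ₀ (z i q.2))) k =
      -∑ j, A k j * ((√(q.1 : ℝ))⁻¹ * ∑ i : Fin q.1, S.ψ₀ (z i q.2) j) := by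
    rw [← map_sum, ← map_smul]
    change ((-A) *ᵥ ((√(q.1 : ℝ))⁻¹ • ∑ i : Fin q.1, S.ψ₀ (z i q.2)).ofLp) k = _
    simp [Matrix.mulVec, dotProduct, Finset.sum_apply]
  have hDj : ∀ j, D q j = √(q.1 : ℝ) * (C.psiHat z S q.1 S.β₀ q.2) j -
      (√(q.1 : ℝ))⁻¹ * ∑ i : Fin q.1, S.ψ₀ (z i q.2) j := fun j => by
    simp [hD, Finset.sum_apply]
  change _ = √(q.1 : ℝ) * (βhat q.1 q.2 - S.β₀) k -
    ((√(q.1 : ℝ))⁻¹ • ∑ i : Fin q.1, Matrix.toEuclideanLin (-A) (S.ψ₀ (z i q.2))) k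
  rw [hX, hΔ, mul_neg, Finset.mul_sum, ← Finset.sum_add_distrib, ← Finset.sum_neg_distrib,
    sub_neg_eq_add, neg_add_eq_sub, ← Finset.sum_sub_distrib]
  refine Finset.sum_congr rfl fun j _ => ?_
  rw [hDj]
  ring
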